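/- Let $G$ be a finitely generated infinite group with identity $e$, let $S$ be a finite symmetric generating set of $G$, and let $p$ be a real number with $p > 1$. Let $D_p(G)$ be the space of functions $f : G \to \mathbb{C}$ with $\sum_{g \in G} |f(gs^{-1}) - f(g)|^p < \infty$ for all $s \in S$, with the pseudonorm $\|f\| = \left(\sum_{s \in S} \sum_{g \in G} |f(gs^{-1}) - f(g)|^p\right)^{1/p}$ and the norm $\|f\|_{D_p} = \left(\|f\|^p + |f(e)|^p\right)^{1/p}$; identify $\mathbb{C}$ with the constant functions and give $D_p(G)/\mathbb{C}$ the norm induced by $\|\cdot\|$. Let $BD_p(G)$ be the algebra (under pointwise operations) of bounded functions in $D_p(G)$, let $Sp(BD_p(G))$ be the set of its characters, i.e. of the nonzero algebra homomorphisms $BD_p(G) \to \mathbb{C}$, and regard $G$ as a subset of $Sp(BD_p(G))$ through $g \mapsto (f \mapsto f(g))$. Let $B(\overline{\mathbb{C}G})_{D_p}$ be the set of bounded functions in the $\|\cdot\|_{D_p}$-closure in $D_p(G)$ of the space $\mathbb{C}G$ of finitely supported functions. The $p$-harmonic boundary of $G$ is $$\partial_p(G) = \{ x \in Sp(BD_p(G))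 \setminus G \mid x(f) = 0 \text{ for all } f \in B(\overline{\mathbb{C}G})_{D_p} \}.$$ For $x \in G$, let $f_x(g) = f(gx^{-1})$. A linear functional $T$ on $D_p(G)/\mathbb{C}$ is translation invariant if $T([f_x]) = T([f])$ for all $f \in D_p(G)$ and $x \in G$. Then $\partial_p(G)$ has more than one element if and only if there exists a nonzero continuous translation invariant linear functional on $D_p(G)/\mathbb{C}$. -/

import Mathlib

/-- A finite symmetric generating set of a group. -/
structure SymmGenSet (G : Type*) [Group G] where
  carrier : Finset G
  inv_mem : ∀ s ∈ carrier, s⁻¹ ∈ carrier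
  closure_eq_top : Subgroup.closure (carrier : Set G) = ⊤

namespace PHarmonic

/-- `∑_{s ∈ S} ∑_{g ∈ G} |f(g s⁻¹) - f(g)|^p`. -/
noncomputable def dirichletSum {G : Type*} [Group G] (S : SymmGenSet G) (p : ℝ) (f : G → ℂ) : ℝ :=
  ∑ s ∈ S.carrier, ∑' g : G, ‖f (g * s⁻¹) - f g‖ ^ p

/-- The pseudonorm `‖f‖ = (∑_{s ∈ S} ∑_{g ∈ G} |f(g s⁻¹) - f(g)|^p)^{1/p}` (used on `D_p(G)`). -/
noncomputable def dirichletNorm {G : Type*} [Group G] (S : SymmGenSet G) (p : ℝ) (f : G → ℂ) : ℝ :=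
  dirichletSum S p f ^ (1 / p)

/-- The norm `‖f‖_{D_p} = (‖f‖^p + |f(e)|^p)^{1/p}` of `D_p(G)`. -/
noncomputable def dpNorm {G : Type*} [Group G] (S : SymmGenSet G) (p : ℝ) (f : G → ℂ) : ℝ :=
  (dirichletNorm S p f ^ p + ‖f 1‖ ^ p) ^ (1 / p)

theorem summable_add_rpow {α : Type*} {p : ℝ} (hp : 1 ≤ p) {u v : α → ℂ}
    (hu : Summable fun a => ‖u a‖ ^ p) (hv : Summable fun a => ‖v a‖ ^ p) :
    Summable fun a => ‖u a + v a‖ ^ p := by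
  have h0 : (0 : ℝ) ≤ p := by linarith
  refine Summable.of_nonneg_of_le (fun a => by positivity) (fun a => ?_)
    (Real.Lp_add_le_tsum_of_nonneg hp (fun a => norm_nonneg (u a)) (fun a => norm_nonneg (v a))
      hu hv).1
  exact Real.rpow_le_rpow (norm_nonneg _) (norm_add_le _ _) h0

/-- The space `D_p(G)` of `p`-Dirichlet finite complex functions on `G`. -/
def Dp {G : Type*} [Group G] (S : SymmGenSet G) {p : ℝ} (hp : 1 ≤ p) : Submodule ℂ (G → ℂ) where
  carrier := {f | ∀ s ∈ S.carrier, Summable fun g : G => ‖f (g * s⁻¹) - f g‖ ^ p}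
  add_mem' {a b} ha hb s hs := by
    have h := summable_add_rpow hp (ha s hs) (hb s hs)
    refine h.congr fun g => ?_
    simp only [Pi.add_apply]
    congr 2
    ring
  zero_mem' s _ := by
    have h0 : p ≠ 0 := by linarith
    simp [Real.zero_rpow h0, summable_zero]
  smul_mem' c f hf s hs := by
    refine ((hf s hs).mul_left (‖c‖ ^ p)).congr fun g => ?_
    rw [← Real.mul_rpow (norm_nonneg _) (norm_nonneg _), ← norm_mul]
    simp [mul_sub]

theorem const_mem_Dp {G : Type*} [Group G] (S : SymmGenSet G) {p : ℝ} (hp : 1 ≤ p) (c : ℂ) :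
    (fun _ : G => c) ∈ Dp S hp := by
  intro s _
  have h0 : p ≠ 0 := by linarith
  simp [Real.zero_rpow h0, summable_zero]

theorem summable_translate_sub {G : Type*} [Group G] (S : SymmGenSet G) {p : ℝ} (hp : 1 ≤ p)
    {f : G → ℂ} (hf : f ∈ Dp S hp) (x : G) :
    Summable fun g : G => ‖f (g * x⁻¹) - f g‖ ^ p := by
  have hx : x ∈ Subgroup.closure (S.carrier : Set G) := by simp [S.closure_eq_top]
  induction hx using Subgroup.closure_induction with
  | mem s hs => exact hf s hs
  | one =>
    have h0 : p ≠ 0 := by linarith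
    simp [Real.zero_rpow h0, summable_zero]
  | mul x y _ _ hx hy =>
    have h1 := (Equiv.mulRight y⁻¹).summable_iff.mpr hx
    refine (summable_add_rpow hp h1 hy).congr fun g => ?_
    simp [mul_assoc]
  | inv x _ hx =>
    have h1 := (Equiv.mulRight x).summable_iff.mpr hx
    refine h1.congr fun g => ?_
    simp [norm_sub_rev]

theorem translate_mem_Dp {G : Type*} [Group G] (S : SymmGenSet G) {p : ℝ} (hp : 1 ≤ p)
    {f : G → ℂ} (hf : f ∈ Dp S hp) (x : G) : (fun g => f (g * x⁻¹)) ∈ Dp S hp := by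
  intro s _
  have h1 := summable_translate_sub S hp hf (x * s)
  have h2 := summable_translate_sub S hp hf x
  have h3 : Summable fun g : G => ‖-(f (g * x⁻¹) - f g)‖ ^ p := by simpa only [norm_neg] using h2
  refine (summable_add_rpow hp h1 h3).congr fun g => ?_
  simp [mul_assoc]

/-- The right translation `f ↦ f_x`, `f_x(g) = f(g x⁻¹)`, on `D_p(G)`. -/
def translate {G : Type*} [Group G] (S : SymmGenSet G) {p : ℝ} (hp : 1 ≤ p) (x : G) :
    Dp S hp →ₗ[ℂ] Dp S hp where
  toFun f := ⟨fun g => (f : G → ℂ) (g * x⁻¹), translate_mem_Dp S hp f.2 x⟩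
  map_add' _ _ := rfl
  map_smul' _ _ := rfl

/-- The constant functions, as a subspace of `D_p(G)`. -/
def constants {G : Type*} [Group G] (S : SymmGenSet G) {p : ℝ} (hp : 1 ≤ p) :
    Submodule ℂ (Dp S hp) where
  carrier := {f | ∃ c : ℂ, ∀ g : G, (f : G → ℂ) g = c}
  add_mem' := by
    rintro a b ⟨c, hc⟩ ⟨d, hd⟩
    exact ⟨c + d, fun g => by simp [hc g, hd g]⟩
  zero_mem' := ⟨0, fun _ => rfl⟩
  smul_mem' := by
    rintro k a ⟨c, hc⟩
    exact ⟨k * c, fun g => by simp [hc g]⟩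

/-- The quotient space `D_p(G)/ℂ`. It is a type of its own, so that its only topology is the one
of the norm below. -/
def DpModConst {G : Type*} [Group G] (S : SymmGenSet G) {p : ℝ} (hp : 1 ≤ p) : Type _ :=
  Dp S hp ⧸ constants S hp

noncomputable instance {G : Type*} [Group G] (S : SymmGenSet G) {p : ℝ} (hp : 1 ≤ p) :
    AddCommGroup (DpModConst S hp) :=
  inferInstanceAs (AddCommGroup (Dp S hp ⧸ constants S hp))

noncomputable instance {G : Type*} [Group G] (S : SymmGenSet G) {p : ℝ} (hp : 1 ≤ p) :
    Module ℂ (DpModConst S hp) :=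
  inferInstanceAs (Module ℂ (Dp S hp ⧸ constants S hp))

/-- The class `[f]` in `D_p(G)/ℂ` of `f` in `D_p(G)`. -/
def DpModConst.mk {G : Type*} [Group G] (S : SymmGenSet G) {p : ℝ} (hp : 1 ≤ p) :
    Dp S hp →ₗ[ℂ] DpModConst S hp :=
  (constants S hp).mkQ

theorem DpModConst.mk_surjective {G : Type*} [Group G] (S : SymmGenSet G) {p : ℝ} (hp : 1 ≤ p) :
    Function.Surjective (DpModConst.mk S hp) :=
  (constants S hp).mkQ_surjective

theorem dirichletSum_nonneg {G : Type*} [Group G] (S : SymmGenSet G) (p : ℝ) (f : G → ℂ) :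
    0 ≤ dirichletSum S p f :=
  Finset.sum_nonneg fun _ _ => tsum_nonneg fun _ => by positivity

theorem dirichletNorm_congr {G : Type*} [Group G] (S : SymmGenSet G) {p : ℝ} (hp : 1 ≤ p)
    (a b : Dp S hp) (h : a - b ∈ constants S hp) :
    dirichletNorm S p (a : G → ℂ) = dirichletNorm S p (b : G → ℂ) := by
  obtain ⟨c, hc⟩ := h
  have hab : ∀ g, (a : G → ℂ) g = (b : G → ℂ) g + c := fun g => by
    rw [← hc g]
    simp
  simp only [dirichletNorm, dirichletSum, hab, add_sub_add_right_eq_sub]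

/-- The norm of `D_p(G)/ℂ` induced by the pseudonorm: `‖[f]‖ = ‖f‖`. -/
noncomputable instance {G : Type*} [Group G] (S : SymmGenSet G) {p : ℝ} (hp : 1 ≤ p) :
    Norm (DpModConst S hp) where
  norm F := Quotient.liftOn' F (fun f : Dp S hp => dirichletNorm S p (f : G → ℂ))
    fun a b h => dirichletNorm_congr S hp a b ((Submodule.quotientRel_def _).mp h)

theorem norm_mk {G : Type*} [Group G] (S : SymmGenSet G) {p : ℝ} (hp : 1 ≤ p) (f : Dp S hp) :
    ‖DpModConst.mk S hp f‖ = dirichletNorm S p (f : G → ℂ) := rfl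

theorem dirichletNorm_smul {G : Type*} [Group G] (S : SymmGenSet G) {p : ℝ} (hp : 1 ≤ p)
    (c : ℂ) (f : G → ℂ) : dirichletNorm S p (c • f) = ‖c‖ * dirichletNorm S p f := by
  have h0 : p ≠ 0 := by linarith
  have h : dirichletSum S p (c • f) = ‖c‖ ^ p * dirichletSum S p f := by
    simp only [dirichletSum, Finset.mul_sum, ← tsum_mul_left, Pi.smul_apply, smul_eq_mul,
      ← mul_sub, norm_mul]
    refine Finset.sum_congr rfl fun s _ => tsum_congr fun g => ?_
    rw [Real.mul_rpow (norm_nonneg _) (norm_nonneg _)]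
  rw [dirichletNorm, h, Real.mul_rpow (by positivity) (dirichletSum_nonneg S p f), one_div,
    Real.rpow_rpow_inv (norm_nonneg _) h0, dirichletNorm, one_div]

theorem dirichletNorm_add_le {G : Type*} [Group G] (S : SymmGenSet G) {p : ℝ} (hp : 1 ≤ p)
    (a b : Dp S hp) :
    dirichletNorm S p ((a : G → ℂ) + (b : G → ℂ)) ≤
      dirichletNorm S p (a : G → ℂ) + dirichletNorm S p (b : G → ℂ) := by
  have h0 : p ≠ 0 := by linarith
  have h0' : 0 ≤ p := by linarith
  let N : (G → ℂ) → G → ℝ := fun f s => (∑' g : G, ‖f (g * s⁻¹) - f g‖ ^ p) ^ (1 / p)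
  have hN0 : ∀ f s, 0 ≤ N f s := fun f s =>
    Real.rpow_nonneg (tsum_nonneg fun _ => by positivity) _
  have hN : ∀ f, dirichletNorm S p f = (∑ s ∈ S.carrier, N f s ^ p) ^ (1 / p) := by
    intro f
    rw [dirichletNorm, dirichletSum]
    congr 1
    refine Finset.sum_congr rfl fun s _ => ?_
    simp only [N, one_div]
    rw [Real.rpow_inv_rpow (tsum_nonneg fun _ => by positivity) h0]
  have hadd : ∀ s ∈ S.carrier, N ((a : G → ℂ) + (b : G → ℂ)) s ≤ N a s + N b s := by
    intro s hs
    have hm := Real.Lp_add_le_tsum_of_nonneg hp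
      (fun g => norm_nonneg ((a : G → ℂ) (g * s⁻¹) - (a : G → ℂ) g))
      (fun g => norm_nonneg ((b : G → ℂ) (g * s⁻¹) - (b : G → ℂ) g)) (a.2 s hs) (b.2 s hs)
    refine le_trans ?_ hm.2
    refine Real.rpow_le_rpow (tsum_nonneg fun _ => by positivity) ?_ (by positivity)
    refine Summable.tsum_le_tsum (fun g => ?_) ((a + b).2 s hs) hm.1
    refine Real.rpow_le_rpow (norm_nonneg _) ?_ h0'
    refine le_trans (le_of_eq ?_) (norm_add_le _ _)
    simp only [Pi.add_apply]
    congr 1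
    ring
  rw [hN, hN, hN]
  refine le_trans ?_ (Real.Lp_add_le_of_nonneg S.carrier hp (fun s _ => hN0 a s)
    fun s _ => hN0 b s)
  refine Real.rpow_le_rpow (Finset.sum_nonneg fun s _ => Real.rpow_nonneg (hN0 _ s) _) ?_
    (by positivity)
  exact Finset.sum_le_sum fun s hs => Real.rpow_le_rpow (hN0 _ s) (hadd s hs) h0'

theorem mem_constants_of_dirichletNorm_eq_zero {G : Type*} [Group G] (S : SymmGenSet G) {p : ℝ}
    (hp : 1 ≤ p) (f : Dp S hp) (h : dirichletNorm S p (f : G → ℂ) = 0) : f ∈ constants S hp := by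
  have h0 : p ≠ 0 := by linarith
  have hs0 : dirichletSum S p (f : G → ℂ) = 0 :=
    (Real.rpow_eq_zero (dirichletSum_nonneg S p _) (by positivity)).mp h
  have hinv : ∀ s ∈ S.carrier, ∀ g : G, (f : G → ℂ) (g * s⁻¹) = (f : G → ℂ) g := by
    intro s hs g
    have h1 := (Finset.sum_eq_zero_iff_of_nonneg
      fun _ _ => tsum_nonneg fun _ => by positivity).mp hs0 s hs
    have h2 := congrFun (((f.2 s hs).hasSum_iff.mpr h1 |> (hasSum_zero_iff_of_nonneg
      fun _ => by positivity).mp)) g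
    have h3 := (Real.rpow_eq_zero (norm_nonneg _) h0).mp h2
    exact sub_eq_zero.mp (norm_eq_zero.mp h3)
  have hall : ∀ x : G, ∀ g : G, (f : G → ℂ) (g * x⁻¹) = (f : G → ℂ) g := by
    intro x
    have hx : x ∈ Subgroup.closure (S.carrier : Set G) := by simp [S.closure_eq_top]
    induction hx using Subgroup.closure_induction with
    | mem s hs => exact hinv s hs
    | one => simp
    | mul x y _ _ hx hy =>
      intro g
      rw [mul_inv_rev, ← mul_assoc, hx, hy]
    | inv x _ hx =>
      intro g
      have := hx (g * x)
      simpa using this.symm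
  exact ⟨(f : G → ℂ) 1, fun g => by simpa using hall g⁻¹ 1⟩

theorem dpModConst_core {G : Type*} [Group G] (S : SymmGenSet G) {p : ℝ} (hp : 1 ≤ p) :
    NormedSpace.Core ℂ (DpModConst S hp) where
  norm_nonneg F := by
    obtain ⟨f, rfl⟩ := DpModConst.mk_surjective S hp F
    rw [norm_mk]
    exact Real.rpow_nonneg (dirichletSum_nonneg S p _) _
  norm_smul c F := by
    obtain ⟨f, rfl⟩ := DpModConst.mk_surjective S hp F
    rw [← map_smul, norm_mk, norm_mk]
    exact dirichletNorm_smul S hp c f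
  norm_triangle F K := by
    obtain ⟨f, rfl⟩ := DpModConst.mk_surjective S hp F
    obtain ⟨k, rfl⟩ := DpModConst.mk_surjective S hp K
    rw [← map_add, norm_mk, norm_mk, norm_mk]
    exact dirichletNorm_add_le S hp f k
  norm_eq_zero_iff F := by
    obtain ⟨f, rfl⟩ := DpModConst.mk_surjective S hp F
    constructor
    · intro h
      exact (Submodule.Quotient.mk_eq_zero _).mpr (mem_constants_of_dirichletNorm_eq_zero S hp f h)
    · intro h
      rw [h, ← map_zero (DpModConst.mk S hp), norm_mk]
      simpa using dirichletNorm_smul S hp 0 (0 : G → ℂ)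

noncomputable instance {G : Type*} [Group G] (S : SymmGenSet G) {p : ℝ} (hp : 1 ≤ p) :
    NormedAddCommGroup (DpModConst S hp) :=
  NormedAddCommGroup.ofCore (dpModConst_core S hp)

noncomputable instance {G : Type*} [Group G] (S : SymmGenSet G) {p : ℝ} (hp : 1 ≤ p) :
    NormedSpace ℂ (DpModConst S hp) :=
  NormedSpace.ofCore (dpModConst_core S hp)

/-- The right translation `[f] ↦ [f_x]` on `D_p(G)/ℂ`. -/
def translateMod {G : Type*} [Group G] (S : SymmGenSet G) {p : ℝ} (hp : 1 ≤ p) (x : G) :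
    DpModConst S hp →ₗ[ℂ] DpModConst S hp :=
  (constants S hp).mapQ (constants S hp) (translate S hp x)
    fun _ ⟨c, hc⟩ => ⟨c, fun g => hc (g * x⁻¹)⟩

/-- `T` is a (right) translation invariant linear functional on `D_p(G)/ℂ`. -/
def IsTILF {G : Type*} [Group G] (S : SymmGenSet G) {p : ℝ} (hp : 1 ≤ p)
    (T : DpModConst S hp →ₗ[ℂ] ℂ) : Prop :=
  ∀ (x : G) (F : DpModConst S hp), T (translateMod S hp x F) = T F

theorem mul_mem_Dp {G : Type*} [Group G] (S : SymmGenSet G) {p : ℝ} (hp : 1 ≤ p) {a b : G → ℂ}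
    (ha : a ∈ Dp S hp) (hb : b ∈ Dp S hp) {A B : ℝ} (hA : ∀ g, ‖a g‖ ≤ A) (hB : ∀ g, ‖b g‖ ≤ B) :
    a * b ∈ Dp S hp := by
  intro s hs
  have h0 : 0 ≤ p := by linarith
  have key : ∀ (u v : G → ℂ) (C : ℝ), (∀ g, ‖u g‖ ≤ C) → (Summable fun g => ‖v g‖ ^ p) →
      Summable fun g => ‖u g * v g‖ ^ p := by
    intro u v C hC hv
    refine Summable.of_nonneg_of_le (fun g => by positivity) (fun g => ?_) (hv.mul_left (C ^ p))
    have hC0 : 0 ≤ C := (norm_nonneg _).trans (hC g)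
    rw [norm_mul, ← Real.mul_rpow hC0 (norm_nonneg _)]
    exact Real.rpow_le_rpow (by positivity)
      (mul_le_mul_of_nonneg_right (hC g) (norm_nonneg _)) h0
  have h1 := key (fun g => a (g * s⁻¹)) _ A (fun g => hA _) (hb s hs)
  have h2 := key b _ B hB (ha s hs)
  refine (summable_add_rpow hp h1 h2).congr fun g => ?_
  simp only [Pi.mul_apply]
  congr 2
  ring

/-- The algebra `BD_p(G)` of bounded functions in `D_p(G)`, with pointwise operations. -/
def BDp {G : Type*} [Group G] (S : SymmGenSet G) {p : ℝ} (hp : 1 ≤ p) : Subalgebra ℂ (G → ℂ) where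
  carrier := {f | f ∈ Dp S hp ∧ ∃ C : ℝ, ∀ g, ‖f g‖ ≤ C}
  mul_mem' := by
    rintro a b ⟨ha, A, hA⟩ ⟨hb, B, hB⟩
    refine ⟨mul_mem_Dp S hp ha hb hA hB, A * B, fun g => ?_⟩
    rw [Pi.mul_apply, norm_mul]
    exact mul_le_mul (hA g) (hB g) (norm_nonneg _) ((norm_nonneg _).trans (hA g))
  add_mem' := by
    rintro a b ⟨ha, A, hA⟩ ⟨hb, B, hB⟩
    exact ⟨(Dp S hp).add_mem ha hb, A + B, fun g =>
      (norm_add_le _ _).trans (add_le_add (hA g) (hB g))⟩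
  algebraMap_mem' c := ⟨const_mem_Dp S hp c, ‖c‖, fun _ => le_rfl⟩

/-- The spectrum `Sp(BD_p(G))`: the set of characters, that is, of nonzero (linear and
multiplicative) homomorphisms from `BD_p(G)` to `ℂ`. -/
def Spectrum {G : Type*} [Group G] (S : SymmGenSet G) {p : ℝ} (hp : 1 ≤ p) : Type _ :=
  {τ : BDp S hp →ₙₐ[ℂ] ℂ // τ ≠ 0}

/-- The embedding `i : G → Sp(BD_p(G))`, `i(g)(f) = f(g)`. -/
def eval {G : Type*} [Group G] (S : SymmGenSet G) {p : ℝ} (hp : 1 ≤ p) (g : G) : Spectrum S hp :=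
  ⟨{ toFun := fun f => (f : G → ℂ) g
     map_smul' := fun _ _ => rfl
     map_zero' := rfl
     map_add' := fun _ _ => rfl
     map_mul' := fun _ _ => rfl },
    fun h => one_ne_zero (α := ℂ) (DFunLike.congr_fun h (1 : BDp S hp))⟩

/-- The closure of `ℂG`, the finitely supported functions, in `D_p(G)` for the norm
`‖·‖_{D_p}`. -/
def closureCG {G : Type*} [Group G] (S : SymmGenSet G) {p : ℝ} (hp : 1 ≤ p) : Set (G → ℂ) :=
  {f | f ∈ Dp S hp ∧
    ∀ ε : ℝ, 0 < ε → ∃ h : G → ℂ, (Function.support h).Finite ∧ dpNorm S p (f - h) < ε}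

/-- The `p`-harmonic boundary `∂_p(G)`: the characters of `BD_p(G)` that are not in `G` and vanish
on every bounded function in the closure of `ℂG` in `D_p(G)`. -/
def harmonicBoundary {G : Type*} [Group G] (S : SymmGenSet G) {p : ℝ} (hp : 1 ≤ p) :
    Set (Spectrum S hp) :=
  {x | x ∉ Set.range (eval S hp) ∧
    ∀ f : BDp S hp, (f : G → ℂ) ∈ closureCG S hp → x.1 f = 0}

end PHarmonic

/-! Everything rests on the ideal `I` of `BD_p(G)` formed by the bounded functions in the closure of
`ℂG`. For `p > 1` and `G` infinite, the continuous translation invariant functionals are exactly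
those vanishing on `ℂG`. Invariance forces equal values on all point masses, and a sum of `n` of
them has norm only `O(n^{1/p})`, so that value is zero (`IsTILF.apply_pointMass`). Conversely `f_x -
f` is in `ℓ^p`, hence in the closure of `ℂG` (`isTILF_of_apply_finiteSupport`).

If no such functional is nonzero, Hahn–Banach makes `ℂG` dense in `D_p(G)/ℂ`. A boundary point
forces `1 ∉ I`, and then density lifts from the quotient: each bounded `f` is a constant `c` plus an
element of `I` (`exists_sub_const_mem_closureCG`). Every boundary character takes the value `c` at
`f`, so there is at most one.

If a nonzero one exists, it kills constants and `I`; bounded functions being dense, some bounded `f`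
lies outside `ℂ + I`. The sets `{|u| < δ}` with `u ∈ I` generate a proper filter, and ultrafilters
finer than it give boundary points. If `f` had a limit `c` along the filter, cutting off small
values would put `f - c` in `I` (`mem_closureCG_of_tendsto_boundaryFilter`). So `f` has different
limits along two ultrafilters, which gives two boundary points. -/

namespace PHarmonic

open Filter Topology

/-! ### Convergence in `D_p(G)` and the closure of `ℂG`. -/

section Convergence

variable {G : Type*} [Group G] {S : SymmGenSet G} {p : ℝ}

theorem rpow_add_le_mul {p : ℝ} (hp : 1 ≤ p) {a b : ℝ} (ha : 0 ≤ a) (hb : 0 ≤ b) :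
    (a + b) ^ p ≤ 2 ^ p * (a ^ p + b ^ p) := by
  have h := NNReal.rpow_add_le_mul_rpow_add_rpow ⟨a, ha⟩ ⟨b, hb⟩ hp
  have h' : (a + b) ^ p ≤ 2 ^ (p - 1) * (a ^ p + b ^ p) := by exact_mod_cast h
  refine h'.trans (mul_le_mul_of_nonneg_right ?_ (by positivity))
  exact Real.rpow_le_rpow_of_exponent_le (by norm_num) (by linarith)

theorem dpNorm_eq (hp : 1 ≤ p) (f : G → ℂ) :
    dpNorm S p f = (dirichletSum S p f + ‖f 1‖ ^ p) ^ (1 / p) := by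
  have h0 : p ≠ 0 := by linarith
  rw [dpNorm, dirichletNorm, one_div, Real.rpow_inv_rpow (dirichletSum_nonneg S p f) h0]

theorem dirichletSum_add_le (hp : 1 ≤ p) {a b : G → ℂ} (ha : a ∈ Dp S hp) (hb : b ∈ Dp S hp) :
    dirichletSum S p (a + b) ≤ 2 ^ p * (dirichletSum S p a + dirichletSum S p b) := by
  rw [dirichletSum, dirichletSum, dirichletSum, ← Finset.sum_add_distrib, Finset.mul_sum]
  refine Finset.sum_le_sum fun s hs => ?_
  rw [← (ha s hs).tsum_add (hb s hs), ← tsum_mul_left]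
  refine Summable.tsum_le_tsum (fun g => ?_) ((Dp S hp).add_mem ha hb s hs)
    (((ha s hs).add (hb s hs)).mul_left _)
  refine le_trans ?_ (rpow_add_le_mul hp (norm_nonneg _) (norm_nonneg _))
  refine Real.rpow_le_rpow (norm_nonneg _) (le_trans (le_of_eq ?_) (norm_add_le _ _)) (by linarith)
  simp only [Pi.add_apply]
  congr 1
  ring

theorem dirichletSum_smul (hp : 1 ≤ p) (c : ℂ) (f : G → ℂ) :
    dirichletSum S p (c • f) = ‖c‖ ^ p * dirichletSum S p f := by
  have h0 : p ≠ 0 := by linarith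
  have h := congrArg (· ^ p) (dirichletNorm_smul S hp c f)
  simpa [dirichletNorm, Real.mul_rpow (norm_nonneg c)
    (Real.rpow_nonneg (dirichletSum_nonneg S p f) _),
    Real.rpow_inv_rpow (dirichletSum_nonneg S p _) h0] using h

theorem rpow_norm_sub_le_dirichletSum (hp : 1 ≤ p) {f : G → ℂ} (hf : f ∈ Dp S hp) {s : G}
    (hs : s ∈ S.carrier) (g : G) : ‖f (g * s⁻¹) - f g‖ ^ p ≤ dirichletSum S p f := by
  refine ((hf s hs).le_tsum g fun _ _ => by positivity).trans ?_
  exact Finset.single_le_sum (f := fun s => ∑' g : G, ‖f (g * s⁻¹) - f g‖ ^ p)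
    (fun _ _ => tsum_nonneg fun _ => by positivity) hs

/-- Convergence in `D_p(G)` implies pointwise convergence. -/
theorem tendsto_apply_of_dirichletSum (hp : 1 ≤ p) {ι : Type*} {l : Filter ι} {k : ι → G → ℂ}
    (hk : ∀ i, k i ∈ Dp S hp) (h : Tendsto (fun i => dirichletSum S p (k i)) l (𝓝 0))
    (h1 : Tendsto (fun i => k i 1) l (𝓝 0)) (g : G) : Tendsto (fun i => k i g) l (𝓝 0) := by
  have h0 : p ≠ 0 := by linarith
  have h0' : 0 < p := by linarith
  -- For generators the energy bounds each single difference; general `x` follows by telescoping.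
  have key : ∀ x : G, ∀ g : G, Tendsto (fun i => k i (g * x⁻¹) - k i g) l (𝓝 0) := by
    intro x
    have hx : x ∈ Subgroup.closure (S.carrier : Set G) := by simp [S.closure_eq_top]
    induction hx using Subgroup.closure_induction with
    | mem s hs =>
      intro g
      rw [tendsto_zero_iff_norm_tendsto_zero]
      have h2 : Tendsto (fun i => dirichletSum S p (k i) ^ p⁻¹) l (𝓝 0) := by
        have := h.rpow_const (p := p⁻¹) (Or.inr (by positivity))
        rwa [Real.zero_rpow (inv_ne_zero h0)] at this
      refine squeeze_zero (fun _ => norm_nonneg _) (fun i => ?_) h2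
      rw [Real.le_rpow_inv_iff_of_pos (norm_nonneg _) (dirichletSum_nonneg S p _) h0']
      exact rpow_norm_sub_le_dirichletSum hp (hk i) hs g
    | one => simpa using tendsto_const_nhds
    | mul x y _ _ hx hy =>
      intro g
      have := (hx (g * y⁻¹)).add (hy g)
      simpa [mul_assoc] using this
    | inv x _ hx =>
      intro g
      have := (hx (g * x)).neg
      simpa using this
  have := (key g⁻¹ 1).add h1
  simpa using this

/-- Dominated convergence for `ℓ^p` norms, with a dominating family `b i + c` where `b i` tends
to zero in `ℓ^p` and `c` is a fixed element of `ℓ^p`. -/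
theorem tendsto_tsum_rpow_of_le_add (hp : 1 ≤ p) {α ι : Type*} {l : Filter ι} {a b : ι → α → ℝ}
    {c : α → ℝ} (ha : ∀ i x, 0 ≤ a i x) (hb : ∀ i x, 0 ≤ b i x) (hc : ∀ x, 0 ≤ c x)
    (hle : ∀ i x, a i x ≤ b i x + c x) (hbs : ∀ i, Summable fun x => b i x ^ p)
    (hcs : Summable fun x => c x ^ p) (hb0 : Tendsto (fun i => ∑' x, b i x ^ p) l (𝓝 0))
    (ha0 : ∀ x, Tendsto (fun i => a i x) l (𝓝 0)) :
    Tendsto (fun i => ∑' x, a i x ^ p) l (𝓝 0) := by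
  have h0 : p ≠ 0 := by linarith
  have h0' : 0 ≤ p := by linarith
  -- Split `a ≤ b + min a c`: the second term is dominated by the fixed `c` and tends to zero
  -- pointwise, so ordinary dominated convergence applies to it.
  have hmin : ∀ i x, 0 ≤ min (a i x) (c x) := fun i x => le_min (ha i x) (hc x)
  have hms : ∀ i, Summable fun x => min (a i x) (c x) ^ p := fun i =>
    Summable.of_nonneg_of_le (fun x => Real.rpow_nonneg (hmin i x) _)
      (fun x => Real.rpow_le_rpow (hmin i x) (min_le_right _ _) h0') hcs
  have hm : Tendsto (fun i => ∑' x, min (a i x) (c x) ^ p) l (𝓝 0) := by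
    have := tendsto_tsum_of_dominated_convergence (𝓕 := l)
      (f := fun i x => min (a i x) (c x) ^ p) (g := fun _ : α => (0 : ℝ)) hcs ?_ ?_
    · simpa using this
    · intro x
      have h1 : Tendsto (fun i => a i x ^ p) l (𝓝 0) := by
        have := (ha0 x).rpow_const (p := p) (Or.inr h0')
        rwa [Real.zero_rpow h0] at this
      exact squeeze_zero (fun i => Real.rpow_nonneg (hmin i x) _)
        (fun i => Real.rpow_le_rpow (hmin i x) (min_le_left _ _) h0') h1
    · refine Eventually.of_forall fun i x => ?_
      rw [Real.norm_of_nonneg (Real.rpow_nonneg (hmin i x) _)]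
      exact Real.rpow_le_rpow (hmin i x) (min_le_right _ _) h0'
  have hbound : ∀ i x, a i x ^ p ≤ 2 ^ p * (b i x ^ p + min (a i x) (c x) ^ p) := by
    intro i x
    refine le_trans (Real.rpow_le_rpow (ha i x) ?_ h0') (rpow_add_le_mul hp (hb i x) (hmin i x))
    rcases le_total (a i x) (c x) with h | h
    · rw [min_eq_left h]
      linarith [hb i x]
    · rw [min_eq_right h]
      exact hle i x
  have hsum : ∀ i, Summable fun x => 2 ^ p * (b i x ^ p + min (a i x) (c x) ^ p) := fun i =>
    ((hbs i).add (hms i)).mul_left _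
  refine squeeze_zero (fun i => tsum_nonneg fun x => Real.rpow_nonneg (ha i x) _) (fun i => ?_)
    (g := fun i => 2 ^ p * (∑' x, b i x ^ p + ∑' x, min (a i x) (c x) ^ p)) ?_
  · rw [← (hbs i).tsum_add (hms i), ← tsum_mul_left]
    exact Summable.tsum_le_tsum (hbound i) (Summable.of_nonneg_of_le
      (fun x => Real.rpow_nonneg (ha i x) _) (hbound i) (hsum i)) (hsum i)
  · simpa using (hb0.add hm).const_mul (2 ^ p)

/-- Dominated convergence in `D_p(G)`: the differences of `h i` are controlled by those of a
family `v i` tending to `u` and by a fixed `p`-summable function. -/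
theorem tendsto_dirichletSum_of_dominated (hp : 1 ≤ p) {ι : Type*} {l : Filter ι}
    {f u : G → ℂ} {h v : ι → G → ℂ} {c : G → G → ℝ} {K : ℝ} (hK : 0 ≤ K)
    (hf : f ∈ Dp S hp) (hpt : ∀ g, Tendsto (fun i => h i g) l (𝓝 (f g)))
    (huv : ∀ i, u - v i ∈ Dp S hp)
    (hlim : Tendsto (fun i => dirichletSum S p (u - v i)) l (𝓝 0))
    (hc : ∀ s g, 0 ≤ c s g) (hcs : ∀ s ∈ S.carrier, Summable fun g => c s g ^ p)
    (hle : ∀ i, ∀ s ∈ S.carrier, ∀ g, ‖h i (g * s⁻¹) - h i g‖ ≤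
      K * ‖(u - v i) (g * s⁻¹) - (u - v i) g‖ + c s g) :
    Tendsto (fun i => dirichletSum S p (f - h i)) l (𝓝 0) := by
  have h0 : p ≠ 0 := by linarith
  have h0' : 0 ≤ p := by linarith
  have : (0 : ℝ) = ∑ s ∈ S.carrier, 0 := by simp
  rw [this]
  refine tendsto_finsetSum _ fun s hs => ?_
  have hmul : ∀ i g, (K * ‖(u - v i) (g * s⁻¹) - (u - v i) g‖) ^ p =
      K ^ p * ‖(u - v i) (g * s⁻¹) - (u - v i) g‖ ^ p := fun i g =>
    Real.mul_rpow hK (norm_nonneg _)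
  refine tendsto_tsum_rpow_of_le_add hp
    (b := fun i g => K * ‖(u - v i) (g * s⁻¹) - (u - v i) g‖)
    (c := fun g => c s g + ‖f (g * s⁻¹) - f g‖) (fun _ _ => norm_nonneg _)
    (fun _ _ => by positivity) (fun g => add_nonneg (hc s g) (norm_nonneg _)) (fun i g => ?_)
    (fun i => ?_) ?_ ?_ fun g => ?_
  · have h1 := hle i s hs g
    have h2 : (f - h i) (g * s⁻¹) - (f - h i) g =
        (f (g * s⁻¹) - f g) - (h i (g * s⁻¹) - h i g) := by
      simp only [Pi.sub_apply]
      ring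
    rw [h2]
    linarith [norm_sub_le (f (g * s⁻¹) - f g) (h i (g * s⁻¹) - h i g)]
  · simp only [hmul]
    exact ((huv i) s hs).mul_left _
  · refine Summable.of_nonneg_of_le (fun g => Real.rpow_nonneg
      (add_nonneg (hc s g) (norm_nonneg _)) _)
      (fun g => rpow_add_le_mul hp (hc s g) (norm_nonneg _)) ?_
    exact ((hcs s hs).add (hf s hs)).mul_left _
  · simp only [hmul, tsum_mul_left]
    refine squeeze_zero (fun i => mul_nonneg (by positivity) (tsum_nonneg fun _ => by positivity))
      (fun i => mul_le_mul_of_nonneg_left (Finset.single_le_sum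
        (f := fun s => ∑' g : G, ‖(u - v i) (g * s⁻¹) - (u - v i) g‖ ^ p)
        (fun _ _ => tsum_nonneg fun _ => by positivity) hs) (by positivity : 0 ≤ K ^ p)) ?_
    simpa [dirichletSum] using hlim.const_mul (K ^ p)
  · have h1 : ∀ g, Tendsto (fun i => (f - h i) g) l (𝓝 0) := fun g => by
      simpa using (tendsto_const_nhds (x := f g)).sub (hpt g)
    simpa using ((h1 (g * s⁻¹)).sub (h1 g)).norm

/-- The special case of a fixed dominating function. -/
theorem tendsto_dirichletSum_of_le (hp : 1 ≤ p) {ι : Type*} {l : Filter ι}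
    {f : G → ℂ} {h : ι → G → ℂ} {c : G → G → ℝ}
    (hf : f ∈ Dp S hp) (hpt : ∀ g, Tendsto (fun i => h i g) l (𝓝 (f g)))
    (hc : ∀ s g, 0 ≤ c s g) (hcs : ∀ s ∈ S.carrier, Summable fun g => c s g ^ p)
    (hle : ∀ i, ∀ s ∈ S.carrier, ∀ g, ‖h i (g * s⁻¹) - h i g‖ ≤ c s g) :
    Tendsto (fun i => dirichletSum S p (f - h i)) l (𝓝 0) := by
  have h0 : p ≠ 0 := by linarith
  refine tendsto_dirichletSum_of_dominated hp (u := 0) (v := fun _ => 0) le_rfl hf hpt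
    (fun _ => by simp) ?_ hc hcs fun i s hs g => by simpa using hle i s hs g
  simpa [dirichletSum, Real.zero_rpow h0] using tendsto_const_nhds

theorem mem_Dp_of_summable (hp : 1 ≤ p) {k : G → ℂ} (hk : Summable fun g => ‖k g‖ ^ p) :
    k ∈ Dp S hp := by
  intro s _
  have h1 : Summable fun g : G => ‖k (g * s⁻¹)‖ ^ p := (Equiv.mulRight s⁻¹).summable_iff.mpr hk
  simpa [sub_eq_add_neg] using
    summable_add_rpow hp h1 (v := fun g => -k g) (by simpa using hk)

theorem mem_Dp_of_finite_support (hp : 1 ≤ p) {k : G → ℂ} (hk : (Function.support k).Finite) :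
    k ∈ Dp S hp := by
  have h0 : p ≠ 0 := by linarith
  refine mem_Dp_of_summable hp (summable_of_hasFiniteSupport (hk.subset fun g hg => ?_))
  contrapose! hg
  simp_all [Real.zero_rpow h0]

/-- The `D_p` norm consists of the energy and the value at `1`, so convergence of these two
suffices. -/
theorem mem_closureCG_of_tendsto (hp : 1 ≤ p) {ι : Type*} {l : Filter ι} [l.NeBot] {f : G → ℂ}
    {h : ι → G → ℂ} (hf : f ∈ Dp S hp) (hh : ∀ i, (Function.support (h i)).Finite)
    (hlim : Tendsto (fun i => dirichletSum S p (f - h i)) l (𝓝 0))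
    (h1 : Tendsto (fun i => h i 1) l (𝓝 (f 1))) : f ∈ closureCG S hp := by
  have h0 : p ≠ 0 := by linarith
  refine ⟨hf, fun ε hε => ?_⟩
  have h2 : Tendsto (fun i => dpNorm S p (f - h i)) l (𝓝 0) := by
    simp only [dpNorm_eq hp]
    have h3 : Tendsto (fun i => ‖(f - h i) 1‖) l (𝓝 0) := by
      simpa using ((tendsto_const_nhds (x := f 1)).sub h1).norm
    have := (hlim.add (h3.rpow_const (p := p) (Or.inr (by positivity)))).rpow_const (p := 1 / p)
      (Or.inr (by positivity))
    simpa [Real.zero_rpow h0, Real.zero_rpow (inv_ne_zero h0)] using this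
  obtain ⟨i, hi⟩ := (h2.eventually_lt_const hε).exists
  exact ⟨h i, hh i, hi⟩

theorem exists_tendsto_of_mem_closureCG (hp : 1 ≤ p) {f : G → ℂ} (hf : f ∈ closureCG S hp) :
    ∃ h : ℕ → G → ℂ, (∀ n, (Function.support (h n)).Finite) ∧
      Tendsto (fun n => dirichletSum S p (f - h n)) atTop (𝓝 0) ∧
      ∀ g, Tendsto (fun n => h n g) atTop (𝓝 (f g)) := by
  have h0 : 0 < p := by linarith
  choose h hh hn using fun n : ℕ => hf.2 (1 / ((n : ℝ) + 1)) (by positivity)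
  have hnorm : Tendsto (fun n => dpNorm S p (f - h n) ^ p) atTop (𝓝 0) := by
    have h1 : Tendsto (fun n => dpNorm S p (f - h n)) atTop (𝓝 0) :=
      squeeze_zero (fun n => Real.rpow_nonneg (add_nonneg (Real.rpow_nonneg (Real.rpow_nonneg
        (dirichletSum_nonneg S p _) _) _) (by positivity)) _)
        (fun n => (hn n).le) tendsto_one_div_add_atTop_nhds_zero_nat
    have := h1.rpow_const (p := p) (Or.inr h0.le)
    rwa [Real.zero_rpow h0.ne'] at this
  have heq : ∀ n, dpNorm S p (f - h n) ^ p = dirichletSum S p (f - h n) + ‖(f - h n) 1‖ ^ p := by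
    intro n
    have := dirichletSum_nonneg S p (f - h n)
    rw [dpNorm_eq hp, one_div, Real.rpow_inv_rpow (by positivity) h0.ne']
  simp only [heq] at hnorm
  have hS : Tendsto (fun n => dirichletSum S p (f - h n)) atTop (𝓝 0) :=
    squeeze_zero (fun n => dirichletSum_nonneg S p _)
      (fun n => le_add_of_nonneg_right (by positivity)) hnorm
  have hone : Tendsto (fun n => (f - h n) 1) atTop (𝓝 0) := by
    rw [tendsto_zero_iff_norm_tendsto_zero]
    have := (squeeze_zero (fun n => by positivity)
      (fun n => le_add_of_nonneg_left (dirichletSum_nonneg S p (f - h n))) hnorm).rpow_const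
      (p := p⁻¹) (Or.inr (by positivity))
    simpa [Real.zero_rpow, h0.ne', Real.rpow_rpow_inv (norm_nonneg _) h0.ne'] using this
  refine ⟨h, hh, hS, fun g => ?_⟩
  have := tendsto_apply_of_dirichletSum hp
    (fun n => (Dp S hp).sub_mem hf.1 (mem_Dp_of_finite_support hp (hh n))) hS hone g
  simpa using (tendsto_const_nhds (x := f g)).sub this

theorem finite_support_mem_closureCG (hp : 1 ≤ p) {k : G → ℂ}
    (hk : (Function.support k).Finite) : k ∈ closureCG S hp := by
  have h0 : p ≠ 0 := by linarith
  refine mem_closureCG_of_tendsto hp (l := (atTop : Filter ℕ)) (h := fun _ => k)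
    (mem_Dp_of_finite_support hp hk) (fun _ => hk) ?_ tendsto_const_nhds
  simp [dirichletSum, Real.zero_rpow h0]

/-- `closureCG` is closed under limits in `D_p(G)`. -/
theorem mem_closureCG_of_tendsto_closureCG (hp : 1 ≤ p) {ι : Type*} {l : Filter ι} [l.NeBot]
    {f : G → ℂ} {h : ι → G → ℂ} (hf : f ∈ Dp S hp) (hh : ∀ i, h i ∈ closureCG S hp)
    (hlim : Tendsto (fun i => dirichletSum S p (f - h i)) l (𝓝 0))
    (h1 : Tendsto (fun i => h i 1) l (𝓝 (f 1))) : f ∈ closureCG S hp := by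
  have key : ∀ n : ℕ, ∃ k : G → ℂ, (Function.support k).Finite ∧
      dirichletSum S p (f - k) < 1 / ((n : ℝ) + 1) ∧ ‖k 1 - f 1‖ < 1 / ((n : ℝ) + 1) := by
    intro n
    have hε : (0 : ℝ) < 1 / ((n : ℝ) + 1) := by positivity
    set ε : ℝ := 1 / ((n : ℝ) + 1)
    -- Chosen so that two errors of this size, after the factor `2 ^ p` of `dirichletSum_add_le`,
    -- add up to `ε`.
    have hδ : 0 < ε / (2 ^ p * 2) := by positivity
    obtain ⟨i, hi1, hi2⟩ := ((hlim.eventually_lt_const hδ).and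
      (Metric.tendsto_nhds.mp h1 (ε / 2) (by positivity))).exists
    obtain ⟨k, hk, hks, hkt⟩ := exists_tendsto_of_mem_closureCG hp (hh i)
    obtain ⟨m, hm1, hm2⟩ := ((hks.eventually_lt_const hδ).and
      (Metric.tendsto_nhds.mp (hkt 1) (ε / 2) (by positivity))).exists
    rw [dist_eq_norm] at hi2 hm2
    refine ⟨k m, hk m, ?_, ?_⟩
    · have h2 := dirichletSum_add_le hp ((Dp S hp).sub_mem hf (hh i).1)
        ((Dp S hp).sub_mem (hh i).1 (mem_Dp_of_finite_support hp (hk m)))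
      rw [sub_add_sub_cancel] at h2
      refine h2.trans_lt ?_
      calc 2 ^ p * (dirichletSum S p (f - h i) + dirichletSum S p (h i - k m))
          < 2 ^ p * (ε / (2 ^ p * 2) + ε / (2 ^ p * 2)) := by gcongr
        _ = ε := by field_simp; ring
    · have := norm_add_le (k m 1 - h i 1) (h i 1 - f 1)
      rw [sub_add_sub_cancel] at this
      linarith
  choose k hk hk1 hk2 using key
  refine mem_closureCG_of_tendsto hp hf hk (l := atTop)
    (squeeze_zero (fun n => dirichletSum_nonneg S p _) (fun n => (hk1 n).le)
      tendsto_one_div_add_atTop_nhds_zero_nat) ?_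
  rw [tendsto_iff_norm_sub_tendsto_zero]
  exact squeeze_zero (fun n => norm_nonneg _) (fun n => (hk2 n).le)
    tendsto_one_div_add_atTop_nhds_zero_nat

end Convergence

/-! ### Truncations, and the ideal of bounded functions in the closure of `ℂG`. -/

section Ideal

/-- The factor by which the retraction of `ℂ` onto the ball of radius `r` scales `z`. -/
noncomputable def radialFactor (r : ℝ) (z : ℂ) : ℝ := r / max r ‖z‖

theorem radialFactor_nonneg {r : ℝ} (hr : 0 < r) (z : ℂ) : 0 ≤ radialFactor r z := by
  unfold radialFactor
  positivity

theorem radialFactor_le_one {r : ℝ} (hr : 0 < r) (z : ℂ) : radialFactor r z ≤ 1 :=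
  div_le_one_of_le₀ (le_max_left _ _) (by positivity)

theorem radialFactor_mul_norm_le {r : ℝ} (hr : 0 < r) (z : ℂ) : radialFactor r z * ‖z‖ ≤ r := by
  have : 0 < max r ‖z‖ := lt_max_of_lt_left hr
  rw [radialFactor, div_mul_eq_mul_div, div_le_iff₀ this]
  exact mul_le_mul_of_nonneg_left (le_max_right _ _) hr.le

theorem radialFactor_eq_one {r : ℝ} (hr : 0 < r) {z : ℂ} (h : ‖z‖ ≤ r) : radialFactor r z = 1 := by
  rw [radialFactor, max_eq_left h, div_self hr.ne']

/-- Both products `radialFactor r z * max r ‖z‖` and `radialFactor r w * max r ‖w‖` equal `r`, so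
the difference reduces to that of the maxima, which is 1-Lipschitz. The weight `max r ‖w‖` serves
twice: it dominates `r` for the factor itself and `‖w‖` for the clamp. -/
theorem abs_radialFactor_sub_mul_le {r : ℝ} (hr : 0 < r) (z w : ℂ) :
    |radialFactor r z - radialFactor r w| * max r ‖w‖ ≤ ‖z - w‖ := by
  have hz : 0 < max r ‖z‖ := lt_max_of_lt_left hr
  have hw : 0 < max r ‖w‖ := lt_max_of_lt_left hr
  have h1 : (radialFactor r z - radialFactor r w) * max r ‖w‖ =
      radialFactor r z * (max r ‖w‖ - max r ‖z‖) := by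
    unfold radialFactor
    field_simp
  have h2 : |max r ‖w‖ - max r ‖z‖| ≤ ‖z - w‖ := by
    rw [max_comm r, max_comm r, norm_sub_rev]
    exact (abs_max_sub_max_le_abs ‖w‖ ‖z‖ r).trans (abs_norm_sub_norm_le w z)
  have h3 := congrArg abs h1
  rw [abs_mul, abs_of_pos hw] at h3
  rw [h3, abs_mul, abs_of_nonneg (radialFactor_nonneg hr z)]
  calc radialFactor r z * |max r ‖w‖ - max r ‖z‖| ≤ 1 * ‖z - w‖ :=
        mul_le_mul (radialFactor_le_one hr z) h2 (abs_nonneg _) zero_le_one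
    _ = ‖z - w‖ := one_mul _

theorem norm_radialFactor_sub_le {r : ℝ} (hr : 0 < r) (z w : ℂ) :
    ‖(radialFactor r z : ℂ) - radialFactor r w‖ ≤ r⁻¹ * ‖z - w‖ := by
  rw [← Complex.ofReal_sub, Complex.norm_real, Real.norm_eq_abs, inv_mul_eq_div, le_div_iff₀ hr]
  exact (mul_le_mul_of_nonneg_left (le_max_left _ _) (abs_nonneg _)).trans
    (abs_radialFactor_sub_mul_le hr z w)

/-- The retraction of `ℂ` onto the closed ball of radius `r`. -/
noncomputable def radialClamp (r : ℝ) (z : ℂ) : ℂ := radialFactor r z * z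

theorem norm_radialClamp_le {r : ℝ} (hr : 0 < r) (z : ℂ) : ‖radialClamp r z‖ ≤ r := by
  rw [radialClamp, norm_mul, Complex.norm_real, Real.norm_of_nonneg (radialFactor_nonneg hr z)]
  exact radialFactor_mul_norm_le hr z

theorem radialClamp_eq_self {r : ℝ} (hr : 0 < r) {z : ℂ} (h : ‖z‖ ≤ r) : radialClamp r z = z := by
  simp [radialClamp, radialFactor_eq_one hr h]

/-- A product rule with one unit for each term; the constant 2 is not sharp, but any Lipschitz
constant would do. -/
theorem norm_radialClamp_sub_le {r : ℝ} (hr : 0 < r) (z w : ℂ) :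
    ‖radialClamp r z - radialClamp r w‖ ≤ 2 * ‖z - w‖ := by
  have h1 : radialClamp r z - radialClamp r w =
      radialFactor r z * (z - w) + ((radialFactor r z - radialFactor r w : ℝ) : ℂ) * w := by
    unfold radialClamp
    push_cast
    ring
  rw [h1]
  refine (norm_add_le _ _).trans ?_
  rw [norm_mul, norm_mul, Complex.norm_real, Complex.norm_real, Real.norm_eq_abs,
    Real.norm_eq_abs, abs_of_nonneg (radialFactor_nonneg hr z)]
  have h2 := mul_le_mul_of_nonneg_right (radialFactor_le_one hr z) (norm_nonneg (z - w))
  have h3 := (mul_le_mul_of_nonneg_left (le_max_right r ‖w‖)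
    (abs_nonneg (radialFactor r z - radialFactor r w))).trans (abs_radialFactor_sub_mul_le hr z w)
  linarith

theorem tendsto_of_norm_sub_le {ι : Type*} {l : Filter ι} {ψ : ℂ → ℂ} {L : ℝ}
    (hψ : ∀ z w, ‖ψ z - ψ w‖ ≤ L * ‖z - w‖) {u : ι → ℂ} {a : ℂ} (hu : Tendsto u l (𝓝 a)) :
    Tendsto (fun i => ψ (u i)) l (𝓝 (ψ a)) := by
  rw [tendsto_iff_norm_sub_tendsto_zero] at hu ⊢
  exact squeeze_zero (fun _ => norm_nonneg _) (fun i => hψ _ _) (by simpa using hu.const_mul L)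

variable {G : Type*} [Group G] {S : SymmGenSet G} {p : ℝ}

theorem comp_mem_Dp (hp : 1 ≤ p) {ψ : ℂ → ℂ} {L : ℝ} (hL : 0 ≤ L)
    (hψ : ∀ z w, ‖ψ z - ψ w‖ ≤ L * ‖z - w‖) {f : G → ℂ} (hf : f ∈ Dp S hp) :
    (fun g => ψ (f g)) ∈ Dp S hp := by
  intro s hs
  refine Summable.of_nonneg_of_le (fun _ => by positivity) (fun g => ?_)
    ((hf s hs).mul_left (L ^ p))
  rw [← Real.mul_rpow hL (norm_nonneg _)]
  exact Real.rpow_le_rpow (norm_nonneg _) (hψ _ _) (by linarith)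

theorem comp_mem_BDp (hp : 1 ≤ p) {ψ : ℂ → ℂ} {L : ℝ} (hL : 0 ≤ L)
    (hψ : ∀ z w, ‖ψ z - ψ w‖ ≤ L * ‖z - w‖) {f : G → ℂ} (hf : f ∈ BDp S hp) :
    (fun g => ψ (f g)) ∈ BDp S hp := by
  obtain ⟨hf, C, hC⟩ := hf
  refine ⟨comp_mem_Dp hp hL hψ hf, L * C + ‖ψ 0‖, fun g => ?_⟩
  have h1 := hψ (f g) 0
  rw [sub_zero] at h1
  have h2 := mul_le_mul_of_nonneg_left (hC g) hL
  have h3 := norm_sub_norm_le (ψ (f g)) (ψ 0)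
  linarith

theorem conj_mem_BDp (hp : 1 ≤ p) {f : G → ℂ} (hf : f ∈ BDp S hp) :
    (fun g => (starRingEnd ℂ) (f g)) ∈ BDp S hp :=
  comp_mem_BDp hp zero_le_one (fun z w => by rw [← map_sub, RCLike.norm_conj, one_mul]) hf

theorem radialFactor_mem_BDp (hp : 1 ≤ p) {r : ℝ} (hr : 0 < r) {f : G → ℂ} (hf : f ∈ BDp S hp) :
    (fun g => (radialFactor r (f g) : ℂ)) ∈ BDp S hp :=
  comp_mem_BDp hp (ψ := fun z => (radialFactor r z : ℂ)) (by positivity)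
    (norm_radialFactor_sub_le hr) hf

theorem radialClamp_mem_BDp (hp : 1 ≤ p) {r : ℝ} (hr : 0 < r) {f : G → ℂ} (hf : f ∈ Dp S hp) :
    (fun g => radialClamp r (f g)) ∈ BDp S hp :=
  ⟨comp_mem_Dp hp zero_le_two (norm_radialClamp_sub_le hr) hf, r,
    fun _ => norm_radialClamp_le hr _⟩

theorem add_mem_closureCG (hp : 1 ≤ p) {a b : G → ℂ} (ha : a ∈ closureCG S hp)
    (hb : b ∈ closureCG S hp) : a + b ∈ closureCG S hp := by
  obtain ⟨h, hh, hs, ht⟩ := exists_tendsto_of_mem_closureCG hp ha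
  obtain ⟨k, kh, ks, kt⟩ := exists_tendsto_of_mem_closureCG hp hb
  refine mem_closureCG_of_tendsto hp (h := fun n => h n + k n) ((Dp S hp).add_mem ha.1 hb.1)
    (fun n => ((hh n).union (kh n)).subset (Function.support_add _ _)) ?_ ((ht 1).add (kt 1))
  refine squeeze_zero (fun n => dirichletSum_nonneg S p _) (fun n => ?_)
    (by simpa using (hs.add ks).const_mul (2 ^ p))
  rw [add_sub_add_comm]
  exact dirichletSum_add_le hp ((Dp S hp).sub_mem ha.1 (mem_Dp_of_finite_support hp (hh n)))
    ((Dp S hp).sub_mem hb.1 (mem_Dp_of_finite_support hp (kh n)))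

/-- The bounded functions in the closure of `ℂG` form an ideal of `BD_p(G)`. -/
theorem mul_mem_closureCG (hp : 1 ≤ p) {a u : G → ℂ} (ha : a ∈ BDp S hp)
    (hu : u ∈ closureCG S hp) (hb : u ∈ BDp S hp) : a * u ∈ closureCG S hp := by
  obtain ⟨h, hh, hs, ht⟩ := exists_tendsto_of_mem_closureCG hp hu
  have hau := (BDp S hp).mul_mem ha hb
  obtain ⟨haD, A, hA⟩ := ha
  obtain ⟨-, M₀, hM₀⟩ := hb
  -- The approximants `h n` need not be uniformly bounded; clamping them at radius `M` repairs this
  -- and leaves `u` unchanged. The maximum with 1 only makes the radius positive.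
  obtain ⟨M, hM, hMpos⟩ : ∃ M : ℝ, (∀ g, ‖u g‖ ≤ M) ∧ 0 < M :=
    ⟨max M₀ 1, fun g => (hM₀ g).trans (le_max_left _ _), by positivity⟩
  have hA0 : 0 ≤ A := (norm_nonneg _).trans (hA 1)
  have hpt : ∀ g, Tendsto (fun n => a g * radialClamp M (h n g)) atTop (𝓝 ((a * u) g)) := by
    intro g
    have := tendsto_of_norm_sub_le (norm_radialClamp_sub_le hMpos) (ht g)
    rw [radialClamp_eq_self hMpos (hM g)] at this
    exact this.const_mul (a g)
  refine mem_closureCG_of_tendsto hp (h := fun n g => a g * radialClamp M (h n g)) hau.1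
    (fun n => (hh n).subset fun g hg => ?_) ?_ (hpt 1)
  · contrapose! hg
    rw [Function.notMem_support] at hg ⊢
    simp [hg, radialClamp]
  · refine tendsto_dirichletSum_of_dominated hp (u := u) (v := h) (K := 2 * A)
      (c := fun s g => 2 * A * ‖u (g * s⁻¹) - u g‖ + M * ‖a (g * s⁻¹) - a g‖) (by positivity)
      hau.1 hpt (fun n => (Dp S hp).sub_mem hu.1 (mem_Dp_of_finite_support hp (hh n))) hs
      (fun s g => by positivity) (fun s hs => ?_) fun n s hs g => ?_
    · refine Summable.of_nonneg_of_le (fun g => by positivity)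
        (fun g => rpow_add_le_mul hp (by positivity) (by positivity)) (Summable.mul_left _ ?_)
      simp only [Real.mul_rpow (by positivity : 0 ≤ 2 * A) (norm_nonneg _),
        Real.mul_rpow hMpos.le (norm_nonneg _)]
      exact ((hu.1 s hs).mul_left _).add ((haD s hs).mul_left _)
    · set x := g * s⁻¹
      -- Leibniz rule; the differences of `h n` are then compared with those of `u` and of `u - h
      -- n`, the latter having energy tending to zero.
      have h1 : a x * radialClamp M (h n x) - a g * radialClamp M (h n g) =
          a x * (radialClamp M (h n x) - radialClamp M (h n g)) +
            radialClamp M (h n g) * (a x - a g) := by ring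
      have h2 : h n x - h n g = (u x - u g) - ((u - h n) x - (u - h n) g) := by
        simp only [Pi.sub_apply]
        ring
      have h3 : ‖h n x - h n g‖ ≤ ‖u x - u g‖ + ‖(u - h n) x - (u - h n) g‖ := by
        rw [h2]
        exact norm_sub_le _ _
      have h4 : ‖a x * (radialClamp M (h n x) - radialClamp M (h n g))‖ ≤
          A * (2 * (‖u x - u g‖ + ‖(u - h n) x - (u - h n) g‖)) := by
        rw [norm_mul]
        refine mul_le_mul (hA x) ((norm_radialClamp_sub_le hMpos _ _).trans ?_) (norm_nonneg _) hA0
        linarith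
      have h5 : ‖radialClamp M (h n g) * (a x - a g)‖ ≤ M * ‖a x - a g‖ := by
        rw [norm_mul]
        exact mul_le_mul_of_nonneg_right (norm_radialClamp_le hMpos _) (norm_nonneg _)
      rw [h1]
      refine (norm_add_le _ _).trans ?_
      linarith

/-- The function `f` is a multiple of `u` in `BD_p(G)`. With `α = radialFactor δ u`, the bounded
Dirichlet function `δ⁻² α² conj u` equals `1 / u` where `‖u‖ ≥ δ`, and elsewhere `f` vanishes. -/
theorem mem_closureCG_of_eq_zero_of_norm_lt (hp : 1 ≤ p) {f u : G → ℂ} (hf : f ∈ BDp S hp)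
    (hu : u ∈ closureCG S hp) (hb : u ∈ BDp S hp) {δ : ℝ} (hδ : 0 < δ)
    (hfu : ∀ g, ‖u g‖ < δ → f g = 0) : f ∈ closureCG S hp := by
  have hα := radialFactor_mem_BDp hp hδ hb
  have h1 := (BDp S hp).smul_mem ((BDp S hp).mul_mem hf ((BDp S hp).mul_mem
    ((BDp S hp).mul_mem hα hα) (conj_mem_BDp hp hb))) ((δ : ℂ) ^ 2)⁻¹
  convert mul_mem_closureCG hp h1 hu hb using 1
  ext g
  simp only [Pi.mul_apply, Pi.smul_apply, smul_eq_mul]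
  rcases lt_or_ge ‖u g‖ δ with h | h
  · simp [hfu g h]
  · have hpos : 0 < ‖u g‖ := hδ.trans_le h
    have h2 : (starRingEnd ℂ) (u g) * u g = (‖u g‖ : ℂ) ^ 2 := Complex.conj_mul' _
    have h3 : (δ : ℂ) ≠ 0 := by exact_mod_cast hδ.ne'
    have h4 : (‖u g‖ : ℂ) ≠ 0 := by exact_mod_cast hpos.ne'
    have h5 : (radialFactor δ (u g) : ℂ) = δ / ‖u g‖ := by
      rw [radialFactor, max_eq_right h]
      push_cast
      rfl
    rw [h5]
    calc f g = ((δ : ℂ) ^ 2)⁻¹ * (f g * (δ / ‖u g‖ * (δ / ‖u g‖) * (‖u g‖ : ℂ) ^ 2)) := by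
          field_simp
      _ = _ := by
          rw [← h2]
          ring

/-- Truncations of `f` converge to `f` in `D_p(G)`. -/
theorem tendsto_dirichletSum_sub_radialClamp (hp : 1 ≤ p) {f : G → ℂ} (hf : f ∈ Dp S hp) :
    Tendsto (fun n : ℕ => dirichletSum S p (f - fun g => radialClamp ((n : ℝ) + 1) (f g)))
      atTop (𝓝 0) := by
  refine tendsto_dirichletSum_of_le hp (c := fun s g => 2 * ‖f (g * s⁻¹) - f g‖) hf (fun g => ?_)
    (fun s g => by positivity) (fun s hs => ?_)
    fun n s hs g => norm_radialClamp_sub_le (by positivity) _ _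
  · refine tendsto_const_nhds.congr' ?_
    filter_upwards [eventually_ge_atTop ⌈‖f g‖⌉₊] with n hn
    rw [radialClamp_eq_self (by positivity)]
    linarith [Nat.ceil_le.mp hn]
  · simp only [Real.mul_rpow zero_le_two (norm_nonneg _)]
    exact (hf s hs).mul_left _

/-- The functions obtained from `f` by cutting off its small values converge to `f` in
`D_p(G)`. -/
theorem tendsto_dirichletSum_radialClamp (hp : 1 ≤ p) {f : G → ℂ} (hf : f ∈ Dp S hp) :
    Tendsto (fun n : ℕ => dirichletSum S p
      (f - fun g => f g - radialClamp (1 / ((n : ℝ) + 1)) (f g))) atTop (𝓝 0) ∧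
    ∀ g, Tendsto (fun n : ℕ => f g - radialClamp (1 / ((n : ℝ) + 1)) (f g)) atTop (𝓝 (f g)) := by
  have hpt : ∀ g, Tendsto (fun n : ℕ => f g - radialClamp (1 / ((n : ℝ) + 1)) (f g)) atTop
      (𝓝 (f g)) := by
    intro g
    have : Tendsto (fun n : ℕ => radialClamp (1 / ((n : ℝ) + 1)) (f g)) atTop (𝓝 0) := by
      rw [tendsto_zero_iff_norm_tendsto_zero]
      exact squeeze_zero (fun _ => norm_nonneg _)
        (fun n => norm_radialClamp_le (by positivity) _) tendsto_one_div_add_atTop_nhds_zero_nat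
    simpa using (tendsto_const_nhds (x := f g)).sub this
  -- The constant is 1 for the identity plus 2 for the clamp, uniformly in the radius.
  refine ⟨tendsto_dirichletSum_of_le hp (c := fun s g => 3 * ‖f (g * s⁻¹) - f g‖) hf hpt
    (fun s g => by positivity) (fun s hs => ?_) fun n s hs g => ?_, hpt⟩
  · simp only [Real.mul_rpow zero_le_three (norm_nonneg _)]
    exact (hf s hs).mul_left _
  · rw [sub_sub_sub_comm]
    refine (norm_sub_le _ _).trans ?_
    linarith [norm_radialClamp_sub_le (r := 1 / ((n : ℝ) + 1)) (by positivity)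
      (f (g * s⁻¹)) (f g)]

end Ideal

/-! ### Translation invariant functionals and their values on `ℂG`. -/

section Functionals

variable {G : Type*} [Group G] {S : SymmGenSet G} {p : ℝ}

theorem tendsto_mk (hp : 1 ≤ p) {ι : Type*} {l : Filter ι} {f : Dp S hp} {h : ι → Dp S hp}
    (hlim : Tendsto (fun i => dirichletSum S p ((f : G → ℂ) - (h i : G → ℂ))) l (𝓝 0)) :
    Tendsto (fun i => DpModConst.mk S hp (h i)) l (𝓝 (DpModConst.mk S hp f)) := by
  have h0 : p ≠ 0 := by linarith
  rw [tendsto_iff_norm_sub_tendsto_zero]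
  have h1 := hlim.rpow_const (p := 1 / p) (Or.inr (by positivity))
  rw [Real.zero_rpow (one_div_ne_zero h0)] at h1
  refine h1.congr fun i => ?_
  rw [norm_sub_rev, ← map_sub, norm_mk]
  rfl

open Classical in
/-- The point mass at `x`, as an element of `D_p(G)`. -/
noncomputable def pointMass (S : SymmGenSet G) (hp : 1 ≤ p) (x : G) : Dp S hp :=
  ⟨Pi.single x 1, mem_Dp_of_finite_support hp
    ((Set.finite_singleton x).subset Pi.support_single_subset)⟩

theorem pointMass_eq_translate (hp : 1 ≤ p) (x : G) :
    pointMass S hp x = translate S hp x (pointMass S hp 1) := by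
  classical
  ext g
  simp only [pointMass, translate, LinearMap.coe_mk, AddHom.coe_mk, Pi.single_apply]
  simp [mul_inv_eq_one]

theorem eq_sum_pointMass (hp : 1 ≤ p) (f : Dp S hp) (A : Finset G)
    (hA : ∀ g ∉ A, (f : G → ℂ) g = 0) : f = ∑ x ∈ A, (f : G → ℂ) x • pointMass S hp x := by
  classical
  ext g
  have : ((∑ x ∈ A, (f : G → ℂ) x • pointMass S hp x : Dp S hp) : G → ℂ) g =
      ∑ x ∈ A, (f : G → ℂ) x * (Pi.single x 1 : G → ℂ) g := by
    simp [pointMass]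
  rw [this]
  simp only [Pi.single_apply, mul_ite, mul_one, mul_zero, Finset.sum_ite_eq]
  split_ifs with h
  · rfl
  · exact hA g h

/-- Right translation preserves the `ℓ^p` norm, so that norm controls the energy. -/
theorem dirichletSum_le_card_mul (hp : 1 ≤ p) {k : G → ℂ} (hk : Summable fun g => ‖k g‖ ^ p) :
    dirichletSum S p k ≤ S.carrier.card * (2 ^ p * (2 * ∑' g, ‖k g‖ ^ p)) := by
  rw [← nsmul_eq_mul]
  refine Finset.sum_le_card_nsmul _ _ _ fun s hs => ?_
  have h1 : Summable fun g : G => ‖k (g * s⁻¹)‖ ^ p := (Equiv.mulRight s⁻¹).summable_iff.mpr hk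
  have h2 : ∑' g : G, ‖k (g * s⁻¹)‖ ^ p = ∑' g, ‖k g‖ ^ p :=
    (Equiv.mulRight s⁻¹).tsum_eq fun g => ‖k g‖ ^ p
  rw [two_mul]
  nth_rw 1 [← h2]
  rw [← h1.tsum_add hk, ← tsum_mul_left]
  refine Summable.tsum_le_tsum (fun g => ?_) (mem_Dp_of_summable hp hk s hs)
    ((h1.add hk).mul_left _)
  exact (Real.rpow_le_rpow (norm_nonneg _) (norm_sub_le _ _) (by linarith)).trans
    (rpow_add_le_mul hp (norm_nonneg _) (norm_nonneg _))

/-- A continuous translation invariant functional vanishes on point masses, since the sum of `n`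
of them has norm `O(n^{1/p})`. -/
theorem IsTILF.apply_pointMass [Infinite G] (hp : 1 < p) {T : DpModConst S hp.le →L[ℂ] ℂ}
    (hT : IsTILF S hp.le (T : DpModConst S hp.le →ₗ[ℂ] ℂ)) (x : G) :
    T (DpModConst.mk S hp.le (pointMass S hp.le x)) = 0 := by
  classical
  have h0 : 0 < p := by linarith
  set c := T (DpModConst.mk S hp.le (pointMass S hp.le 1)) with hc
  have hall : ∀ x, T (DpModConst.mk S hp.le (pointMass S hp.le x)) = c := by
    intro x
    rw [pointMass_eq_translate]
    exact hT x (DpModConst.mk S hp.le (pointMass S hp.le 1))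
  rw [hall]
  by_contra hne
  have hcpos : 0 < ‖c‖ := norm_pos_iff.mpr hne
  set K : ℝ := ‖T‖ ^ p * (S.carrier.card * (2 ^ p * 2)) with hK
  -- Testing on the indicator of an `n`-element set gives `n ^ p * ‖c‖ ^ p ≤ K * n`. Dividing by `n`
  -- leaves the exponent `p - 1`, positive because `p > 1`, so the left side is unbounded.
  have hbound : ∀ n : ℕ, 0 < n → (n : ℝ) ^ (p - 1) * ‖c‖ ^ p ≤ K := by
    intro n hn
    have hn' : (0 : ℝ) < n := by exact_mod_cast hn
    obtain ⟨A, hA⟩ := Infinite.exists_subset_card_eq G n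
    set f : Dp S hp.le := ∑ x ∈ A, pointMass S hp.le x
    have hf : ∀ g, (f : G → ℂ) g = if g ∈ A then 1 else 0 := by
      intro g
      have : (f : G → ℂ) g = ∑ x ∈ A, (Pi.single x 1 : G → ℂ) g := by
        simp [f, pointMass]
      rw [this]
      simp [Pi.single_apply]
    have hTf : T (DpModConst.mk S hp.le f) = n * c := by
      simp [f, map_sum, hall, hA]
    have hfp : (fun g => ‖(f : G → ℂ) g‖ ^ p) = fun g => if g ∈ A then 1 else 0 := by
      ext g
      rw [hf]
      split_ifs <;> simp [Real.zero_rpow h0.ne']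
    have hsum : HasSum (fun g => ‖(f : G → ℂ) g‖ ^ p) n := by
      rw [hfp]
      have : HasSum (fun g => if g ∈ A then (1 : ℝ) else 0) (∑ g ∈ A, if g ∈ A then 1 else 0) :=
        hasSum_sum_of_ne_finset_zero fun g hg => by simp [hg]
      simpa [hA] using this
    have h1 := dirichletSum_le_card_mul (S := S) hp.le hsum.summable
    rw [hsum.tsum_eq] at h1
    have h2 := T.le_opNorm (DpModConst.mk S hp.le f)
    rw [hTf, norm_mk, norm_mul, Complex.norm_natCast] at h2
    have h3 := Real.rpow_le_rpow (by positivity) h2 h0.le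
    rw [Real.mul_rpow hn'.le (norm_nonneg _), dirichletNorm, Real.mul_rpow (norm_nonneg _)
      (Real.rpow_nonneg (dirichletSum_nonneg S p _) _), one_div,
      Real.rpow_inv_rpow (dirichletSum_nonneg S p _) h0.ne'] at h3
    have h4 := h3.trans (mul_le_mul_of_nonneg_left h1 (by positivity))
    have h5 : (n : ℝ) ^ p = n * (n : ℝ) ^ (p - 1) := by
      rw [Real.rpow_sub_one hn'.ne']
      field_simp
    rw [h5] at h4
    refine le_of_mul_le_mul_left ?_ hn'
    rw [hK]
    linarith
  have hlim : Tendsto (fun n : ℕ => (n : ℝ) ^ (p - 1) * ‖c‖ ^ p) atTop atTop :=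
    ((tendsto_rpow_atTop (by linarith)).comp tendsto_natCast_atTop_atTop).atTop_mul_const
      (by positivity)
  obtain ⟨n, hn1, hn2⟩ := ((hlim.eventually_gt_atTop K).and (eventually_gt_atTop 0)).exists
  exact absurd (hbound n hn2) (not_le.mpr hn1)

theorem IsTILF.apply_closureCG [Infinite G] (hp : 1 < p) {T : DpModConst S hp.le →L[ℂ] ℂ}
    (hT : IsTILF S hp.le (T : DpModConst S hp.le →ₗ[ℂ] ℂ)) {f : Dp S hp.le}
    (hf : (f : G → ℂ) ∈ closureCG S hp.le) : T (DpModConst.mk S hp.le f) = 0 := by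
  obtain ⟨h, hh, hs, -⟩ := exists_tendsto_of_mem_closureCG hp.le hf
  have h1 := (T.continuous.tendsto _).comp (tendsto_mk hp.le (f := f)
    (h := fun n => ⟨h n, mem_Dp_of_finite_support hp.le (hh n)⟩) hs)
  refine tendsto_nhds_unique h1 (tendsto_const_nhds.congr fun n => ?_)
  rw [Function.comp_apply, eq_sum_pointMass hp.le ⟨h n, _⟩ (hh n).toFinset fun g hg => by
    simpa using hg]
  simp [map_sum, hT.apply_pointMass hp]

/-- A continuous functional on `D_p(G)/ℂ` is determined by its values on bounded functions. -/
theorem eq_zero_of_apply_bounded (hp : 1 ≤ p) {T : DpModConst S hp →L[ℂ] ℂ}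
    (hT : ∀ f : Dp S hp, (f : G → ℂ) ∈ BDp S hp → T (DpModConst.mk S hp f) = 0) : T = 0 := by
  ext F
  obtain ⟨f, rfl⟩ := DpModConst.mk_surjective S hp F
  have h1 := (T.continuous.tendsto _).comp (tendsto_mk hp (f := f)
    (h := fun n : ℕ => ⟨_, (radialClamp_mem_BDp hp (Nat.cast_add_one_pos n) f.2).1⟩)
    (tendsto_dirichletSum_sub_radialClamp hp f.2))
  refine tendsto_nhds_unique h1 (tendsto_const_nhds.congr fun n => ?_)
  exact (hT ⟨_, _⟩ (radialClamp_mem_BDp hp (Nat.cast_add_one_pos n) f.2)).symm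

theorem mk_const (hp : 1 ≤ p) (c : ℂ) : DpModConst.mk S hp ⟨_, const_mem_Dp S hp c⟩ = 0 :=
  (Submodule.Quotient.mk_eq_zero _).mpr ⟨c, fun _ => rfl⟩

/-- If there is a nonzero continuous translation invariant functional, then some bounded function
of `D_p(G)` is not the sum of a constant and an element of the closure of `ℂG`. -/
theorem IsTILF.exists_bounded [Infinite G] (hp : 1 < p) {T : DpModConst S hp.le →L[ℂ] ℂ}
    (hT : IsTILF S hp.le (T : DpModConst S hp.le →ₗ[ℂ] ℂ)) (hT0 : T ≠ 0) :
    ∃ f ∈ BDp S hp.le, ∀ c : ℂ, (fun g => f g - c) ∉ closureCG S hp.le := by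
  by_contra! hcon
  refine hT0 (eq_zero_of_apply_bounded hp.le fun f hf => ?_)
  obtain ⟨c, hc⟩ := hcon f hf
  have h1 : f = ⟨_, hc.1⟩ + ⟨_, const_mem_Dp S hp.le c⟩ := by
    ext g
    simp
  rw [h1, map_add, mk_const, add_zero]
  exact hT.apply_closureCG hp hc

/-- Restrictions to finite sets, along the directed set of finsets, converge by domination. -/
theorem mem_closureCG_of_summable (hp : 1 ≤ p) {k : G → ℂ} (hk : Summable fun g => ‖k g‖ ^ p) :
    k ∈ closureCG S hp := by
  classical
  have hk' := mem_Dp_of_summable (S := S) hp hk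
  have hpt : ∀ g, Tendsto (fun A : Finset G => if g ∈ A then k g else 0) atTop (𝓝 (k g)) := by
    intro g
    refine tendsto_const_nhds.congr' ?_
    filter_upwards [eventually_ge_atTop {g}] with A hA
    rw [if_pos (hA (Finset.mem_singleton_self g))]
  have hle : ∀ (A : Finset G) g, ‖if g ∈ A then k g else 0‖ ≤ ‖k g‖ := by
    intro A g
    split_ifs <;> simp
  refine mem_closureCG_of_tendsto hp (l := atTop)
    (h := fun (A : Finset G) g => if g ∈ A then k g else 0) hk' (fun A => ?_) ?_ (hpt 1)
  · refine A.finite_toSet.subset fun g hg => ?_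
    by_contra hgA
    exact hg (if_neg hgA)
  · refine tendsto_dirichletSum_of_le hp (c := fun s g => ‖k (g * s⁻¹)‖ + ‖k g‖) hk' hpt
      (fun s g => by positivity) (fun s hs => ?_) fun A s hs g =>
        (norm_sub_le _ _).trans (add_le_add (hle A _) (hle A _))
    have h1 : Summable fun g : G => ‖k (g * s⁻¹)‖ ^ p := (Equiv.mulRight s⁻¹).summable_iff.mpr hk
    exact Summable.of_nonneg_of_le (fun g => by positivity)
      (fun g => rpow_add_le_mul hp (norm_nonneg _) (norm_nonneg _)) ((h1.add hk).mul_left _)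

/-- The image of `ℂG` in `D_p(G)/ℂ`. -/
noncomputable def finiteSupportMod (S : SymmGenSet G) (hp : 1 ≤ p) :
    Submodule ℂ (DpModConst S hp) :=
  Submodule.map (DpModConst.mk S hp)
    { carrier := {f : Dp S hp | (Function.support (f : G → ℂ)).Finite}
      add_mem' := fun ha hb => (ha.union hb).subset (Function.support_add _ _)
      zero_mem' := by simp
      smul_mem' := fun c _ ha => ha.subset (Function.support_const_smul_subset c _) }

/-- A continuous functional vanishing on `ℂG` is translation invariant. -/
theorem isTILF_of_apply_finiteSupport (hp : 1 ≤ p) {T : DpModConst S hp →L[ℂ] ℂ}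
    (hT : ∀ F ∈ finiteSupportMod S hp, T F = 0) :
    IsTILF S hp (T : DpModConst S hp →ₗ[ℂ] ℂ) := by
  intro x F
  obtain ⟨f, rfl⟩ := DpModConst.mk_surjective S hp F
  change T (DpModConst.mk S hp (translate S hp x f)) = T (DpModConst.mk S hp f)
  rw [← sub_eq_zero, ← map_sub, ← map_sub]
  -- Membership in `D_p(G)` says that `f_x - f` is in `ℓ^p` for generators, hence for every `x`.
  have hmem : ((translate S hp x f - f : Dp S hp) : G → ℂ) ∈ closureCG S hp :=
    mem_closureCG_of_summable hp (summable_translate_sub S hp f.2 x)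
  obtain ⟨h, hh, hs, -⟩ := exists_tendsto_of_mem_closureCG hp hmem
  have h1 := (T.continuous.tendsto _).comp (tendsto_mk hp (f := translate S hp x f - f)
    (h := fun n => ⟨h n, mem_Dp_of_finite_support hp (hh n)⟩) hs)
  refine tendsto_nhds_unique h1 (tendsto_const_nhds.congr fun n => ?_)
  exact (hT _ ⟨_, hh n, rfl⟩).symm

/-- If there is no nonzero continuous translation invariant functional, then `ℂG` is dense in
`D_p(G)/ℂ`. -/
theorem topologicalClosure_finiteSupportMod (hp : 1 ≤ p)
    (h : ∀ T : DpModConst S hp →L[ℂ] ℂ, IsTILF S hp (T : DpModConst S hp →ₗ[ℂ] ℂ) → T = 0) :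
    (finiteSupportMod S hp).topologicalClosure = ⊤ := by
  by_contra hne
  obtain ⟨F, -, hF⟩ := SetLike.exists_of_lt (lt_top_iff_ne_top.mpr hne)
  set W := (finiteSupportMod S hp).topologicalClosure with hW
  -- Closedness makes the quotient by `W` normed rather than seminormed; a norming functional there
  -- pulls back to one that vanishes on `ℂG` but not at `F`.
  have hcl : IsClosed (W : Set (DpModConst S hp)) := Submodule.isClosed_topologicalClosure _
  obtain ⟨φ, -, hφ⟩ := exists_dual_vector'' ℂ (W.mkQ F)
  have hT := h (φ.comp W.mkQL) (isTILF_of_apply_finiteSupport hp fun K hK => by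
    have : W.mkQ K = 0 := (Submodule.Quotient.mk_eq_zero W).mpr
      (Submodule.le_topologicalClosure _ hK)
    change φ (W.mkQ K) = 0
    rw [this, map_zero])
  have h1 : φ (W.mkQ F) = 0 := DFunLike.congr_fun hT F
  rw [h1] at hφ
  have h2 : ‖W.mkQ F‖ = 0 := Complex.ofReal_eq_zero.mp hφ.symm
  exact hF ((Submodule.Quotient.mk_eq_zero W).mp (norm_eq_zero.mp h2))

end Functionals

/-! ### Boundary characters from ultrafilters, and uniqueness under density. -/

section Boundary

variable {G : Type*} [Group G] {S : SymmGenSet G} {p : ℝ}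

/-- A bounded function takes values in a compact ball, where every ultrafilter converges. -/
theorem tendsto_limUnder_ultrafilter (hp : 1 ≤ p) (U : Ultrafilter G) {f : G → ℂ}
    (hf : f ∈ BDp S hp) : Tendsto f U (𝓝 (limUnder (U : Filter G) f)) := by
  obtain ⟨-, C, hC⟩ := hf
  obtain ⟨z, -, hz⟩ := (isCompact_closedBall (0 : ℂ) C).ultrafilter_le_nhds (U.map f)
    (le_principal_iff.mpr (Filter.Eventually.of_forall (p := fun g => f g ∈ Metric.closedBall 0 C)
      fun g => by simpa using hC g))
  exact tendsto_nhds_limUnder ⟨z, hz⟩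

/-- The character `f ↦ lim_U f` of `BD_p(G)` given by an ultrafilter `U` on `G`. -/
noncomputable def ultrafilterCharacter (S : SymmGenSet G) (hp : 1 ≤ p) (U : Ultrafilter G) :
    Spectrum S hp :=
  ⟨{ toFun := fun f => limUnder (U : Filter G) (f : G → ℂ)
     map_smul' := fun c f => tendsto_nhds_unique (tendsto_limUnder_ultrafilter hp U (c • f).2)
       ((tendsto_limUnder_ultrafilter hp U f.2).const_smul c)
     map_zero' := tendsto_nhds_unique (tendsto_limUnder_ultrafilter hp U (0 : BDp S hp).2)
       tendsto_const_nhds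
     map_add' := fun f k => tendsto_nhds_unique (tendsto_limUnder_ultrafilter hp U (f + k).2)
       ((tendsto_limUnder_ultrafilter hp U f.2).add (tendsto_limUnder_ultrafilter hp U k.2))
     map_mul' := fun f k => tendsto_nhds_unique (tendsto_limUnder_ultrafilter hp U (f * k).2)
       ((tendsto_limUnder_ultrafilter hp U f.2).mul (tendsto_limUnder_ultrafilter hp U k.2)) },
    fun h => one_ne_zero (α := ℂ) ((tendsto_nhds_unique
      (tendsto_limUnder_ultrafilter hp U (1 : BDp S hp).2) tendsto_const_nhds).symm.trans
        (DFunLike.congr_fun h (1 : BDp S hp)))⟩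

theorem tendsto_ultrafilterCharacter (hp : 1 ≤ p) (U : Ultrafilter G) (f : BDp S hp) :
    Tendsto (f : G → ℂ) U (𝓝 ((ultrafilterCharacter S hp U).1 f)) :=
  tendsto_limUnder_ultrafilter hp U f.2

/-- The filter on `G` generated by the sets `{|u| < δ}`, with `u` bounded in the closure of
`ℂG`. -/
def boundaryFilter (S : SymmGenSet G) (hp : 1 ≤ p) : Filter G where
  sets := {A | ∃ u ∈ closureCG S hp, u ∈ BDp S hp ∧ ∃ δ : ℝ, 0 < δ ∧ ∀ g, ‖u g‖ < δ → g ∈ A}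
  univ_sets := ⟨0, finite_support_mem_closureCG hp (by simp), (BDp S hp).zero_mem, 1, one_pos,
    fun _ _ => trivial⟩
  sets_of_superset := by
    rintro A B ⟨u, hu, hb, δ, hδ, h⟩ hAB
    exact ⟨u, hu, hb, δ, hδ, fun g hg => hAB (h g hg)⟩
  inter_sets := by
    rintro A B ⟨u, hu, hub, δ, hδ, hA⟩ ⟨v, hv, hvb, η, hη, hB⟩
    -- The witness is `|u|² + |v|²`: it stays in the ideal, and without cancellation its smallness
    -- makes both `u` and `v` small.
    refine ⟨(fun g => (starRingEnd ℂ) (u g)) * u + (fun g => (starRingEnd ℂ) (v g)) * v,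
      add_mem_closureCG hp (mul_mem_closureCG hp (conj_mem_BDp hp hub) hu hub)
        (mul_mem_closureCG hp (conj_mem_BDp hp hvb) hv hvb),
      (BDp S hp).add_mem ((BDp S hp).mul_mem (conj_mem_BDp hp hub) hub)
        ((BDp S hp).mul_mem (conj_mem_BDp hp hvb) hvb), min (δ ^ 2) (η ^ 2), by positivity,
      fun g hg => ?_⟩
    have h1 : ‖((fun g => (starRingEnd ℂ) (u g)) * u + (fun g => (starRingEnd ℂ) (v g)) * v) g‖ =
        ‖u g‖ ^ 2 + ‖v g‖ ^ 2 := by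
      simp only [Pi.add_apply, Pi.mul_apply, Complex.conj_mul']
      rw [← Complex.ofReal_pow, ← Complex.ofReal_pow, ← Complex.ofReal_add, Complex.norm_real,
        Real.norm_of_nonneg (by positivity)]
    rw [h1, lt_min_iff] at hg
    exact ⟨hA g (lt_of_pow_lt_pow_left₀ 2 hδ.le (by linarith [sq_nonneg ‖v g‖])),
      hB g (lt_of_pow_lt_pow_left₀ 2 hη.le (by linarith [sq_nonneg ‖u g‖]))⟩

theorem mem_boundaryFilter (hp : 1 ≤ p) {A : Set G} : A ∈ boundaryFilter S hp ↔
    ∃ u ∈ closureCG S hp, u ∈ BDp S hp ∧ ∃ δ : ℝ, 0 < δ ∧ ∀ g, ‖u g‖ < δ → g ∈ A := Iff.rfl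

theorem tendsto_boundaryFilter (hp : 1 ≤ p) {u : G → ℂ} (hu : u ∈ closureCG S hp)
    (hb : u ∈ BDp S hp) : Tendsto u (boundaryFilter S hp) (𝓝 0) := by
  rw [Metric.tendsto_nhds]
  intro ε hε
  exact ⟨u, hu, hb, ε, hε, fun g hg => by simpa using hg⟩

/-- The point mass at `g` lies in the ideal, so the character vanishes there, whereas evaluation at
`g` gives 1. -/
theorem ultrafilterCharacter_mem_harmonicBoundary (hp : 1 ≤ p) {U : Ultrafilter G}
    (hU : (U : Filter G) ≤ boundaryFilter S hp) :
    ultrafilterCharacter S hp U ∈ harmonicBoundary S hp := by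
  classical
  have hvan : ∀ f : BDp S hp, (f : G → ℂ) ∈ closureCG S hp →
      (ultrafilterCharacter S hp U).1 f = 0 := fun f hf =>
    tendsto_nhds_unique (tendsto_ultrafilterCharacter hp U f)
      ((tendsto_boundaryFilter hp hf f.2).mono_left hU)
  refine ⟨?_, hvan⟩
  rintro ⟨g, hg⟩
  have hmem : (pointMass S hp g : G → ℂ) ∈ BDp S hp := by
    refine ⟨(pointMass S hp g).2, 1, fun x => ?_⟩
    simp only [pointMass, Pi.single_apply]
    split_ifs <;> simp
  have h1 := hvan ⟨_, hmem⟩ (finite_support_mem_closureCG hp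
    ((Set.finite_singleton g).subset Pi.support_single_subset))
  rw [← hg] at h1
  have h2 : (pointMass S hp g : G → ℂ) g = 0 := h1
  simp [pointMass] at h2

theorem one_notMem_closureCG_of_notMem (hp : 1 ≤ p) {f : G → ℂ} (hf : f ∈ BDp S hp)
    (hfc : f ∉ closureCG S hp) : (1 : G → ℂ) ∉ closureCG S hp := fun h =>
  hfc (by simpa using mul_mem_closureCG hp hf h (BDp S hp).one_mem)

/-- If the empty set belonged to the filter, some `u` in the ideal would be bounded away from zero,
hence invertible in `BD_p(G)`, and the ideal would contain `1`. -/
theorem boundaryFilter_neBot (hp : 1 ≤ p) (h : (1 : G → ℂ) ∉ closureCG S hp) :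
    (boundaryFilter S hp).NeBot := by
  rw [neBot_iff, Ne, ← empty_mem_iff_bot]
  rintro ⟨u, hu, hb, δ, hδ, hsub⟩
  exact h (mem_closureCG_of_eq_zero_of_norm_lt hp (BDp S hp).one_mem hu hb hδ
    fun g hg => (hsub g hg).elim)

/-- A function of `BD_p(G)` that tends to zero along `boundaryFilter` is in the closure of `ℂG`. -/
theorem mem_closureCG_of_tendsto_boundaryFilter (hp : 1 ≤ p) {f : G → ℂ} (hf : f ∈ BDp S hp)
    (hlim : Tendsto f (boundaryFilter S hp) (𝓝 0)) : f ∈ closureCG S hp := by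
  obtain ⟨h1, h2⟩ := tendsto_dirichletSum_radialClamp hp hf.1
  refine mem_closureCG_of_tendsto_closureCG hp hf.1 (fun n => ?_) h1 (h2 1)
  have hn : (0 : ℝ) < 1 / ((n : ℝ) + 1) := by positivity
  obtain ⟨u, hu, hb, δ, hδ, hsub⟩ := (mem_boundaryFilter hp).mp
    (Metric.tendsto_nhds.mp hlim _ hn)
  -- Subtracting the clamp kills `f` wherever `‖f‖ ≤ 1 / (n + 1)`, in particular on `{‖u‖ < δ}`.
  refine mem_closureCG_of_eq_zero_of_norm_lt hp
    ((BDp S hp).sub_mem hf (radialClamp_mem_BDp hp hn hf.1)) hu hb hδ fun g hg => ?_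
  have h3 : ‖f g‖ ≤ 1 / ((n : ℝ) + 1) := by
    have : dist (f g) 0 < 1 / ((n : ℝ) + 1) := hsub g hg
    rw [dist_zero_right] at this
    exact this.le
  exact sub_eq_zero.mpr (radialClamp_eq_self hn h3).symm

theorem exists_ne_of_notMem_closureCG (hp : 1 ≤ p) {f : G → ℂ} (hf : f ∈ BDp S hp)
    (hfc : ∀ c : ℂ, (fun g => f g - c) ∉ closureCG S hp) :
    ∃ x ∈ harmonicBoundary S hp, ∃ y ∈ harmonicBoundary S hp, x ≠ y := by
  have hsub : ∀ c : ℂ, (fun g => f g - c) ∈ BDp S hp := fun c =>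
    (BDp S hp).sub_mem hf ((BDp S hp).algebraMap_mem c)
  have hne := boundaryFilter_neBot hp (one_notMem_closureCG_of_notMem hp (hsub 0) (hfc 0))
  set U := Ultrafilter.of (boundaryFilter S hp)
  have hU : (U : Filter G) ≤ boundaryFilter S hp := Ultrafilter.of_le _
  set c := (ultrafilterCharacter S hp U).1 ⟨f, hf⟩
  have hnot : ¬ Tendsto f (boundaryFilter S hp) (𝓝 c) := fun h =>
    hfc c (mem_closureCG_of_tendsto_boundaryFilter hp (hsub c)
      (by simpa using h.sub_const c))
  rw [tendsto_iff_ultrafilter] at hnot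
  push Not at hnot
  obtain ⟨V, hV, hVc⟩ := hnot
  refine ⟨_, ultrafilterCharacter_mem_harmonicBoundary hp hU, _,
    ultrafilterCharacter_mem_harmonicBoundary hp hV, fun h => hVc ?_⟩
  have h1 := tendsto_ultrafilterCharacter hp V ⟨f, hf⟩
  rwa [← h] at h1

/-- The value is idempotent, and the value 0 would make the whole character vanish. -/
theorem map_one_of_spectrum (hp : 1 ≤ p) (x : Spectrum S hp) : x.1 1 = 1 := by
  have h1 : x.1 1 * x.1 1 = x.1 1 := by rw [← map_mul, one_mul]
  rcases eq_or_ne (x.1 1) 0 with h0 | h0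
  · refine absurd ?_ x.2
    ext f
    have := map_mul x.1 1 f
    rwa [one_mul, h0, zero_mul] at this
  · exact mul_right_cancel₀ h0 (h1.trans (one_mul _).symm)

theorem one_notMem_closureCG_of_mem_harmonicBoundary (hp : 1 ≤ p) {x : Spectrum S hp}
    (hx : x ∈ harmonicBoundary S hp) : (1 : G → ℂ) ∉ closureCG S hp := fun h =>
  one_ne_zero ((map_one_of_spectrum hp x).symm.trans (hx.2 1 h))

/-- The quotient norm sees only the energy; the values at `1` remain uncontrolled, which
`exists_sub_const_mem_closureCG` has to repair. -/
theorem exists_seq_of_mem_topologicalClosure (hp : 1 ≤ p) {f : Dp S hp}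
    (hf : DpModConst.mk S hp f ∈ (finiteSupportMod S hp).topologicalClosure) :
    ∃ h : ℕ → G → ℂ, (∀ n, (Function.support (h n)).Finite) ∧
      Tendsto (fun n => dirichletSum S p ((f : G → ℂ) - h n)) atTop (𝓝 0) := by
  have h0 : 0 < p := by linarith
  obtain ⟨F, hF, hlim⟩ := mem_closure_iff_seq_limit.mp hf
  choose h hh hhF using hF
  refine ⟨fun n => h n, hh, ?_⟩
  rw [tendsto_iff_norm_sub_tendsto_zero] at hlim
  have h1 := hlim.rpow_const (p := p) (Or.inr h0.le)
  rw [Real.zero_rpow h0.ne'] at h1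
  refine h1.congr fun n => ?_
  rw [← hhF, norm_sub_rev, ← map_sub, norm_mk, dirichletNorm, one_div,
    Real.rpow_inv_rpow (dirichletSum_nonneg S p _) h0.ne']
  rfl

theorem dirichletSum_add_const (f : G → ℂ) (c : ℂ) :
    dirichletSum S p (fun g => f g + c) = dirichletSum S p f := by
  simp [dirichletSum]

/-- If `1` is not in the closure of `ℂG`, then a function whose class is a limit of classes of
finitely supported functions is the sum of a constant and an element of the closure of `ℂG`. -/
theorem exists_sub_const_mem_closureCG (hp : 1 ≤ p) (h1 : (1 : G → ℂ) ∉ closureCG S hp)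
    {f : G → ℂ} (hf : f ∈ Dp S hp) {h : ℕ → G → ℂ} (hh : ∀ n, (Function.support (h n)).Finite)
    (hlim : Tendsto (fun n => dirichletSum S p (f - h n)) atTop (𝓝 0)) :
    ∃ c : ℂ, (fun g => f g - c) ∈ closureCG S hp := by
  have h0 : 0 < p := by linarith
  set c : ℕ → ℂ := fun n => f 1 - h n 1 with hc
  have hhD : ∀ n, h n ∈ Dp S hp := fun n => mem_Dp_of_finite_support hp (hh n)
  -- If the defects `c n` at the identity are frequently bounded, a subsequential limit is the
  -- required constant. Otherwise `‖c n‖ → ∞`, and rescaling shows that `1` lies in the closure.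
  by_cases hbdd : ∃ R : ℝ, ∃ᶠ n in atTop, c n ∈ Metric.closedBall (0 : ℂ) R
  · obtain ⟨R, hR⟩ := hbdd
    obtain ⟨a, -, φ, hφ, ha⟩ := tendsto_subseq_of_frequently_bounded Metric.isBounded_closedBall hR
    have hD : (fun g => f g - a) ∈ Dp S hp := (Dp S hp).sub_mem hf (const_mem_Dp S hp a)
    refine ⟨a, mem_closureCG_of_tendsto hp (h := fun n => h (φ n)) hD (fun n => hh _)
      ((hlim.comp hφ.tendsto_atTop).congr fun n => ?_) ?_⟩
    · rw [Function.comp_apply, ← dirichletSum_add_const _ (-a)]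
      congr 1
      ext g
      simp only [Pi.sub_apply]
      ring
    · have := (tendsto_const_nhds (x := f 1)).sub ha
      simpa [hc] using this
  · refine absurd ?_ h1
    push Not at hbdd
    have hinf : Tendsto (fun n => ‖c n‖) atTop atTop := by
      refine tendsto_atTop.mpr fun R => ?_
      filter_upwards [hbdd R] with n hn
      simpa using (lt_of_not_ge (fun h => hn (by simpa using h)) : R < ‖c n‖).le
    have hinv : Tendsto (fun n => (c n)⁻¹) atTop (𝓝 0) := by
      rw [tendsto_zero_iff_norm_tendsto_zero]
      exact hinf.inv_tendsto_atTop.congr fun n => (norm_inv _).symm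
    -- Since `h n 1 = f 1 - c n`, the scaled function takes the value `1 - f 1 / c n` at the
    -- identity, which tends to 1. Its energy is `‖c n‖⁻ᵖ` times an eventually bounded quantity.
    refine mem_closureCG_of_tendsto hp (l := atTop) (h := fun n => (-(c n)⁻¹) • h n)
      (const_mem_Dp S hp 1) (fun n => (hh n).subset (Function.support_const_smul_subset _ _)) ?_ ?_
    · have hb : Tendsto (fun n => ‖(c n)⁻¹‖ ^ p *
          (2 ^ p * (dirichletSum S p f + dirichletSum S p (f - h n)))) atTop (𝓝 0) := by
        have h2 := (hinv.norm.rpow_const (p := p) (Or.inr h0.le)).mul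
          ((hlim.const_add (dirichletSum S p f)).const_mul (2 ^ p))
        simpa [Real.zero_rpow h0.ne'] using h2
      refine squeeze_zero (fun n => dirichletSum_nonneg S p _) (fun n => ?_) hb
      have h3 : dirichletSum S p (1 - (-(c n)⁻¹) • h n) =
          ‖(c n)⁻¹‖ ^ p * dirichletSum S p (h n) := by
        rw [← dirichletSum_smul hp, ← dirichletSum_add_const ((c n)⁻¹ • h n) 1]
        congr 1
        ext g
        simp only [Pi.sub_apply, Pi.smul_apply, Pi.one_apply, smul_eq_mul]
        ring
      have h4 : dirichletSum S p (-(f - h n)) = dirichletSum S p (f - h n) := by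
        have := dirichletSum_smul (S := S) hp (-1) (f - h n)
        simpa using this
      have h5 := dirichletSum_add_le hp hf ((Dp S hp).neg_mem ((Dp S hp).sub_mem hf (hhD n)))
      rw [h4, show f + -(f - h n) = h n by abel] at h5
      rw [h3]
      exact mul_le_mul_of_nonneg_left h5 (by positivity)
    · have h6 : Tendsto (fun n => 1 - (c n)⁻¹ * f 1) atTop (𝓝 1) := by
        simpa using (tendsto_const_nhds (x := (1 : ℂ))).sub (hinv.mul_const (f 1))
      refine h6.congr' ?_
      filter_upwards [hinf.eventually_gt_atTop 0] with n hn
      have hn0 : c n ≠ 0 := norm_pos_iff.mp hn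
      have h7 : h n 1 = f 1 - c n := by simp [hc]
      simp only [Pi.smul_apply, smul_eq_mul, h7]
      field_simp
      ring

/-- Each `f` differs from a constant by an element on which all boundary characters vanish, so that
constant is their common value. -/
theorem eq_of_mem_harmonicBoundary (hp : 1 ≤ p)
    (h : ∀ T : DpModConst S hp →L[ℂ] ℂ, IsTILF S hp (T : DpModConst S hp →ₗ[ℂ] ℂ) → T = 0)
    {x y : Spectrum S hp} (hx : x ∈ harmonicBoundary S hp) (hy : y ∈ harmonicBoundary S hp) :
    x = y := by
  refine Subtype.ext (NonUnitalAlgHom.ext fun f => ?_)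
  have hcl : DpModConst.mk S hp ⟨(f : G → ℂ), f.2.1⟩ ∈
      (finiteSupportMod S hp).topologicalClosure := by
    rw [topologicalClosure_finiteSupportMod hp h]
    trivial
  obtain ⟨k, hk, hlim⟩ := exists_seq_of_mem_topologicalClosure hp hcl
  obtain ⟨c, hc⟩ := exists_sub_const_mem_closureCG hp
    (one_notMem_closureCG_of_mem_harmonicBoundary hp hx) f.2.1 hk hlim
  have key : ∀ z ∈ harmonicBoundary S hp, z.1 f = c := by
    intro z hz
    have hz1 : z.1 (f - c • 1) = 0 := hz.2 _ (by
      convert hc using 1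
      ext g
      simp)
    rw [map_sub, map_smul, map_one_of_spectrum hp z, smul_eq_mul, mul_one] at hz1
    exact sub_eq_zero.mp hz1
  rw [key x hx, key y hy]

end Boundary

end PHarmonic

theorem theorem2p5 {G : Type*} [Group G] [Group.FG G] [Infinite G] (S : SymmGenSet G)
    {p : ℝ} (hp : 1 < p) :
    1 < (PHarmonic.harmonicBoundary S hp.le).encard ↔
      ∃ T : PHarmonic.DpModConst S hp.le →L[ℂ] ℂ,
        T ≠ 0 ∧ PHarmonic.IsTILF S hp.le (T : PHarmonic.DpModConst S hp.le →ₗ[ℂ] ℂ) := by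
  rw [Set.one_lt_encard_iff]
  constructor
  · rintro ⟨x, y, hx, hy, hxy⟩
    by_contra! hcon
    exact hxy (PHarmonic.eq_of_mem_harmonicBoundary hp.le
      (fun T hT => by_contra fun h0 => hcon T h0 hT) hx hy)
  · rintro ⟨T, hT0, hT⟩
    obtain ⟨f, hf, hfc⟩ := hT.exists_bounded hp hT0
    obtain ⟨x, hx, y, hy, hxy⟩ := PHarmonic.exists_ne_of_notMem_closureCG hp.le hf hfc
    exact ⟨x, y, hx, hy, hxy⟩
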